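/- Let $n\ge 0$ and let $h:\mathbb C^n\to[0,\infty)$ be upper semicontinuous with $h(\lambda z)=|\lambda|h(z)$ for all $\lambda\in\mathbb C$, $z\in\mathbb C^n$, so that $D=D_h:=\{z\in\mathbb C^n: h(z)<1\}$ is an arbitrary balanced domain. Let $L^2_h(D)$ be the space of holomorphic functions on $D$ that are square integrable with respect to Lebesgue measure. 1. $L^2_h(D)$ has an orthonormal basis $\{P_{d,j}: d=0,1,2,\dots,\ j\in\mathcal J_d\}$, where each $\mathcal J_d$ is a finite (possibly empty) set and each $P_{d,j}$ is a homogeneous polynomial of degree $d$. 2. For every such orthonormal basis put $$h_{BK}(z):=\limsup_{d\to\infty}\Big(\sum_{j\in\mathcal J_d}|P_{d,j}(z)|^2\Big)^{1/(2d)},\qquad h_{BK}^*(z):=\limsup_{w\to z}h_{BK}(w)\qquad (z\in\mathbb C^n),$$ where $w=z$ is allowed in the second limit superior. Then $h_{BK}^*$ is finite everywhere, upper semicontinuous, and satisfies $h_{BK}^*(\lambda z)=|\lambda|h_{BK}^*(z)$, so that $D_{h_{BK}^*}:=\{z\in\mathbb C^n: h_{BK}^*(z)<1\}$ is a balanced domain;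 and $D\subset D_{h_{BK}^*}$ is the $L^2_h$-envelope of holomorphy of $D$. Here a Riemann domain over $\mathbb C^n$ is a connected Hausdorff space $X$ with a local homeomorphism $p:X\to\mathbb C^n$. An $L^2_h$-extension of $D$ is a Riemann domain $(X,p)$ with a continuous map $\alpha:D\to X$ such that $p\circ\alpha=\mathrm{id}_D$ and for every $f\in L^2_h(D)$ there is a holomorphic function $F$ on $X$ with $F\circ\alpha=f$. The $L^2_h$-envelope of holomorphy of $D$ is the maximal $L^2_h$-extension, i.e. an $L^2_h$-extension $\alpha:D\to(X,p)$ such that for every $L^2_h$-extension $\beta:D\to(Z,r)$ there is a continuous map $\sigma:Z\to X$ with $p\circ\sigma=r$ and $\sigma\circ\beta=\alpha$. A domain $G\supset D$ in $\mathbb C^n$ is regarded as a Riemann domain through its inclusion in $\mathbb C^n$, with the inclusion $D\subset G$ as the map $\alpha$. -/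

import Mathlib

open MeasureTheory Filter Topology
open scoped ENNReal

universe v w

noncomputable section

/-! ### Balanced domains -/

/-- The functions `h : ℂⁿ → [0, ∞)` that define balanced domains: upper semicontinuous and
absolutely homogeneous. -/
structure IsBalancedFunction {n : ℕ} (h : (Fin n → ℂ) → ℝ) : Prop where
  nonneg : ∀ z, 0 ≤ h z
  upperSemicontinuous : UpperSemicontinuous h
  homogeneous : ∀ (c : ℂ) (z : Fin n → ℂ), h (c • z) = ‖c‖ * h z

/-- `D_h = {z ∈ ℂⁿ : h z < 1}`. -/
def balancedDomain {n : ℕ} (h : (Fin n → ℂ) → ℝ) : Set (Fin n → ℂ) := {z | h z < 1}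

/-! ### The Bergman space `L²_h(D)` -/

/-- `f ∈ L²_h(D)`: `f` is holomorphic on `D` and square integrable on `D` with respect to
Lebesgue measure. (The values of `f` off `D` play no role.) -/
structure IsL2h {n : ℕ} (D : Set (Fin n → ℂ)) (f : (Fin n → ℂ) → ℂ) : Prop where
  differentiableOn : DifferentiableOn ℂ f D
  memLp : MemLp f 2 (volume.restrict D)

/-- `L²_h(D)` as a subspace of the Hilbert space `L²(D)`. -/
def bergmanSpace {n : ℕ} (D : Set (Fin n → ℂ)) :
    Submodule ℂ (Lp ℂ 2 (volume.restrict D)) where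
  carrier := {g | ∃ f, IsL2h D f ∧ g =ᵐ[volume.restrict D] f}
  zero_mem' := ⟨0, ⟨differentiableOn_const 0, MemLp.zero⟩, Lp.coeFn_zero ℂ 2 _⟩
  add_mem' := by
    rintro a b ⟨f, hf, haf⟩ ⟨g, hg, hbg⟩
    exact ⟨f + g, ⟨hf.1.add hg.1, hf.2.add hg.2⟩, (Lp.coeFn_add a b).trans (haf.add hbg)⟩
  smul_mem' := by
    rintro c a ⟨f, hf, haf⟩
    exact ⟨c • f, ⟨hf.1.const_smul c, hf.2.const_smul c⟩,
      (Lp.coeFn_smul c a).trans (haf.const_smul c)⟩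

/-- The family `P d j` (`d ∈ ℕ`, `j` in the finite index set `Fin (N d)`, which may be empty)
consists of homogeneous polynomials, `P d j` of degree `d`, and is an orthonormal basis of the
Hilbert space `L²_h(D)`. -/
def IsHomogeneousOrthonormalBasis {n : ℕ} (D : Set (Fin n → ℂ)) (N : ℕ → ℕ)
    (P : ∀ d, Fin (N d) → MvPolynomial (Fin n) ℂ) : Prop :=
  (∀ d j, (P d j).IsHomogeneous d) ∧
    ∃ b : HilbertBasis (Σ d, Fin (N d)) ℂ (bergmanSpace D), ∀ d j,
      ((b ⟨d, j⟩ : bergmanSpace D) : Lp ℂ 2 (volume.restrict D))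
        =ᵐ[volume.restrict D] fun z => MvPolynomial.eval z (P d j)

/-! ### The function `h_BK` and its upper semicontinuous regularization -/

/-- `h_BK(z) = limsup_{d → ∞} (∑_j |P d j (z)|²)^(1/(2d))`, with values in `[0, ∞]`. -/
def hBK {n : ℕ} {N : ℕ → ℕ} (P : ∀ d, Fin (N d) → MvPolynomial (Fin n) ℂ)
    (z : Fin n → ℂ) : ℝ≥0∞ :=
  limsup (fun d : ℕ =>
    ENNReal.ofReal ((∑ j, ‖MvPolynomial.eval z (P d j)‖ ^ 2) ^ (1 / (2 * (d : ℝ))))) atTop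

/-- The upper semicontinuous regularization `u^*(z) = limsup_{w → z} u(w)` (where `w = z` is
allowed), the smallest upper semicontinuous majorant of `u`. -/
def uscRegularization {n : ℕ} (u : (Fin n → ℂ) → ℝ≥0∞) (z : Fin n → ℂ) : ℝ≥0∞ :=
  limsup u (𝓝 z)

/-- `h_BK^*` as a real-valued function (meaningful where the regularization is finite). -/
def hBKStar {n : ℕ} {N : ℕ → ℕ} (P : ∀ d, Fin (N d) → MvPolynomial (Fin n) ℂ)
    (z : Fin n → ℂ) : ℝ :=
  (uscRegularization (hBK P) z).toReal

/-! ### Riemann domains over `ℂⁿ` and envelopes of holomorphy -/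

/-- A Riemann domain over `ℂⁿ`: a connected Hausdorff space with a local homeomorphism
to `ℂⁿ`. -/
structure RiemannDomain (n : ℕ) where
  carrier : Type v
  [topology : TopologicalSpace carrier]
  [t2 : T2Space carrier]
  [connected : ConnectedSpace carrier]
  proj : carrier → (Fin n → ℂ)
  isLocalHomeomorph_proj : IsLocalHomeomorph proj

attribute [instance] RiemannDomain.topology RiemannDomain.t2 RiemannDomain.connected

namespace RiemannDomain

/-- `F` is holomorphic on the Riemann domain `X`: around each point, `F` composed with the local
inverse of the projection is holomorphic on an open subset of `ℂⁿ`. -/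
def IsHolomorphic {n : ℕ} (X : RiemannDomain.{v} n) (F : X.carrier → ℂ) : Prop :=
  ∀ x : X.carrier, ∃ e : OpenPartialHomeomorph X.carrier (Fin n → ℂ),
    x ∈ e.source ∧ Set.EqOn X.proj e e.source ∧ DifferentiableOn ℂ (F ∘ e.symm) e.target

/-- A domain in `ℂⁿ`, viewed as a (univalent) Riemann domain through its inclusion map. -/
def ofDomain {n : ℕ} (G : Set (Fin n → ℂ)) (hG : IsOpen G) (hc : IsConnected G) :
    RiemannDomain.{0} n :=
  letI : ConnectedSpace G := isConnected_iff_connectedSpace.mp hc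
  { carrier := G
    proj := Subtype.val
    isLocalHomeomorph_proj := hG.isOpenEmbedding_subtypeVal.isLocalHomeomorph }

end RiemannDomain

/-- `α : D → X` is an `L²_h`-extension of the domain `D ⊆ ℂⁿ`: a morphism over `ℂⁿ` of `D` to the
Riemann domain `X` such that every `f ∈ L²_h(D)` extends to a holomorphic function on `X` (which
need not be square integrable). -/
structure IsL2hExtension {n : ℕ} (D : Set (Fin n → ℂ)) (X : RiemannDomain.{v} n)
    (α : D → X.carrier) : Prop where
  continuous : Continuous α
  proj_apply : ∀ z : D, X.proj (α z) = z
  extends_l2h : ∀ f, IsL2h D f →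
    ∃ F : X.carrier → ℂ, X.IsHolomorphic F ∧ ∀ z : D, F (α z) = f z

/-- `α : D → X` is the `L²_h`-envelope of holomorphy of `D`: the maximal `L²_h`-extension, that is,
an `L²_h`-extension through which every other one maps to `X` over `ℂⁿ` and under `D`. -/
structure IsL2hEnvelope {n : ℕ} (D : Set (Fin n → ℂ)) (X : RiemannDomain.{v} n)
    (α : D → X.carrier) : Prop where
  isL2hExtension : IsL2hExtension D X α
  maximal : ∀ (Z : RiemannDomain.{w} n) (β : D → Z.carrier), IsL2hExtension D Z β →
    ∃ σ : Z.carrier → X.carrier, Continuous σ ∧ (∀ y, X.proj (σ y) = Z.proj y) ∧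
      ∀ z : D, σ (β z) = α z

/-- The domain `G ⊆ ℂⁿ` is the `L²_h`-envelope of holomorphy of the domain `D`, with the inclusion
`D ⊆ G` as the structure map. -/
def IsL2hEnvelopeDomain {n : ℕ} (D G : Set (Fin n → ℂ)) : Prop :=
  ∃ (hG : IsOpen G) (hc : IsConnected G) (hDG : D ⊆ G),
    IsL2hEnvelope.{0, w} D (RiemannDomain.ofDomain G hG hc) (Set.inclusion hDG)

end

/-! Part 1 is Fourier analysis on the circle. Rotations z ↦ cz, |c| = 1, preserve both D and
Lebesgue measure, so averaging c⁻ᵈ f(cz) over the circle extracts from f ∈ L²_h(D) its homogeneous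
component of degree d, a polynomial that is again square integrable. Polynomials of different
degrees are orthogonal, and a function orthogonal to all of them has no components, hence vanishes
by its Taylor series along lines through 0. Orthonormal bases of the finite-dimensional homogeneous
pieces therefore combine into one of L²_h(D) (`exists_isHomogeneousOrthonormalBasis`).

Part 2 rests on S_d(z) = ∑_j |P_{d,j}(z)|², the squared norm of evaluation at z on the degree-d
piece. Let G be the set where h_BK^* < 1.

Functions extend to G: near a point of G there is a < 1 such that S_d ≤ a^(2d) eventually, at each
point separately. By Cauchy–Schwarz the degree-d component of f then decays like aᵈ pointwise, and
Hartogs' lemma (`eventually_forall_norm_le_of_forall_eventually`) makes the decay locally uniform at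
the rate √a. The homogeneous expansion of f thus converges to a holomorphic function on G
(`exists_differentiableOn_extension`).

They extend no further: on an L²_h-extension Z, evaluation of the extended functions at each point
is a bounded functional on L²_h(D). This is clear on the image of D and propagates along discs;
Banach–Steinhaus makes the norms locally bounded (`RiemannDomain.exists_clm_norm_le`). Since P_{d,j}
extends as itself composed with the projection, Bessel's inequality bounds S_d independently of d
near every point of the projection of Z. So h_BK ≤ 1 on an open set, and homogeneity sharpens this
to h_BK^* < 1 (`IsL2hExtension.uscRegularization_hBK_lt_one`). Hence Z projects into G, and the
projection is the required morphism. -/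

noncomputable section

/-! ### Limits and derivatives of holomorphic functions of several variables -/

section ComplexAnalysis

variable {E : Type*} [NormedAddCommGroup E] [NormedSpace ℂ E]

/-- Schwarz's lemma to second order. The bound depends only on M and r, so it survives pointwise
limits. -/
lemma norm_sub_sub_fderiv_le {f : E → ℂ} {z : E} {r M : ℝ}
    (hf : DifferentiableOn ℂ f (Metric.ball z r)) (hM : ∀ w ∈ Metric.ball z r, ‖f w‖ ≤ M)
    {w : E} (hw : w ∈ Metric.ball z r) :
    ‖f w - f z - fderiv ℂ f z (w - z)‖ ≤ 4 * M * (‖w - z‖ / r) ^ 2 := by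
  have hr : 0 < r := Metric.nonempty_ball.mp ⟨_, hw⟩
  have hz : z ∈ Metric.ball z r := Metric.mem_ball_self hr
  have hM2 : ∀ w ∈ Metric.ball z r, ‖f w - f z‖ ≤ 2 * M := fun w hw => by
    linarith [norm_sub_le (f w) (f z), hM w hw, hM z hz]
  have hD : ‖fderiv ℂ f z‖ ≤ 2 * M / r :=
    Complex.norm_fderiv_le_div_of_mapsTo_ball hf
      (fun w hw => by simpa [dist_eq_norm] using hM2 w hw) hr
  have hfz : HasFDerivAt f (fderiv ℂ f z) z :=
    (hf.differentiableAt (Metric.ball_mem_nhds z hr)).hasFDerivAt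
  -- The constant 4M is 2M for the increment of f plus (2M / r) · r for its linear part.
  have := Complex.dist_le_mul_div_pow_of_mapsTo_ball_of_isLittleO
    (f := fun w => f w - fderiv ℂ f z (w - z)) (c := z) (z := w) (R₁ := r) (R₂ := 4 * M) (n := 1)
    (hf.sub (by fun_prop)) ?_ ?_ hw
  · simpa [dist_eq_norm, sub_right_comm] using this
  · intro w hw
    have h1 := hM2 w hw
    have h2 : ‖fderiv ℂ f z (w - z)‖ ≤ 2 * M / r * r := by
      refine (ContinuousLinearMap.le_opNorm _ _).trans ?_
      have : ‖w - z‖ ≤ r := by simpa [dist_eq_norm] using (Metric.mem_ball.mp hw).le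
      exact mul_le_mul hD this (norm_nonneg _) ((norm_nonneg _).trans hD)
    rw [div_mul_cancel₀ _ hr.ne'] at h2
    have := norm_sub_le (f w - f z) (fderiv ℂ f z (w - z))
    rw [Metric.mem_closedBall, dist_eq_norm]
    simp only [sub_self, map_zero, sub_zero]
    rw [sub_right_comm]
    linarith
  · have h3 := hfz.isLittleO
    refine (h3.congr_left fun w => ?_).norm_right.congr_right fun w => by simp
    simp [sub_right_comm]

/-- A pointwise limit of locally uniformly bounded holomorphic functions is holomorphic. -/
lemma differentiableAt_of_tendsto [FiniteDimensional ℂ E] {f : ℕ → E → ℂ} {g : E → ℂ} {z : E} {r M : ℝ}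
    (hr : 0 < r) (hf : ∀ᶠ k in atTop, DifferentiableOn ℂ (f k) (Metric.ball z r) ∧
      ∀ w ∈ Metric.ball z r, ‖f k w‖ ≤ M)
    (hg : ∀ w ∈ Metric.ball z r, Tendsto (fun k => f k w) atTop (𝓝 (g w))) :
    DifferentiableAt ℂ g z := by
  have hD : ∀ᶠ k in atTop, fderiv ℂ (f k) z ∈ Metric.closedBall (0 : E →L[ℂ] ℂ) (2 * M / r) := by
    filter_upwards [hf] with k ⟨h1, h2⟩
    rw [mem_closedBall_zero_iff]
    refine Complex.norm_fderiv_le_div_of_mapsTo_ball h1 (fun w hw => ?_) hr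
    rw [Metric.mem_closedBall, dist_eq_norm]
    linarith [norm_sub_le (f k w) (f k z), h2 w hw, h2 z (Metric.mem_ball_self hr)]
  have : ProperSpace (E →L[ℂ] ℂ) := FiniteDimensional.proper ℂ _
  -- The derivatives at z lie in a compact ball by Cauchy's estimate. Any cluster value L serves:
  -- the quadratic remainder bound passes to the limit along the subsequence and makes L the
  -- derivative of g.
  obtain ⟨L, -, φ, hφ, hL⟩ := (isCompact_closedBall (0 : E →L[ℂ] ℂ) (2 * M / r)).tendsto_subseq'
    hD.frequently
  refine HasFDerivAt.differentiableAt (f' := L) ?_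
  have hb : ∀ w ∈ Metric.ball z r, ‖g w - g z - L (w - z)‖ ≤ 4 * M * (‖w - z‖ / r) ^ 2 := by
    intro w hw
    have ht : Tendsto (fun k => ‖f (φ k) w - f (φ k) z - fderiv ℂ (f (φ k)) z (w - z)‖) atTop
        (𝓝 ‖g w - g z - L (w - z)‖) := by
      refine Tendsto.norm (Tendsto.sub (Tendsto.sub ?_ ?_) ?_)
      · exact (hg w hw).comp hφ.tendsto_atTop
      · exact (hg z (Metric.mem_ball_self hr)).comp hφ.tendsto_atTop
      · exact ((ContinuousLinearMap.apply ℂ ℂ (w - z)).continuous.tendsto L).comp hL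
    refine le_of_tendsto ht ?_
    filter_upwards [hφ.tendsto_atTop.eventually hf] with k ⟨h1, h2⟩
    exact norm_sub_sub_fderiv_le h1 h2 hw
  rw [hasFDerivAt_iff_isLittleO]
  have hO : (fun w => g w - g z - L (w - z)) =O[𝓝 z] fun w => ‖w - z‖ ^ 2 := by
    refine Asymptotics.IsBigO.of_bound (4 * M / r ^ 2) ?_
    filter_upwards [Metric.ball_mem_nhds z hr] with w hw
    refine (hb w hw).trans (le_of_eq ?_)
    rw [norm_pow, norm_norm]; ring
  refine hO.trans_isLittleO ?_
  have : Tendsto (fun w : E => ‖w - z‖) (𝓝 z) (𝓝 0) := by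
    have h : Continuous fun w : E => ‖w - z‖ := by fun_prop
    simpa using h.tendsto z
  refine Asymptotics.IsLittleO.of_norm_right ?_
  have h4 := ((Asymptotics.isLittleO_pow_id (n := 2) (𝕜 := ℝ) (by norm_num)).comp_tendsto this)
  exact h4

/-- Directional derivatives of holomorphic functions are holomorphic. -/
lemma DifferentiableOn.fderiv_apply [FiniteDimensional ℂ E] {f : E → ℂ} {U : Set E} (hU : IsOpen U)
    (hf : DifferentiableOn ℂ f U) (v : E) : DifferentiableOn ℂ (fun z => fderiv ℂ f z v) U := by
  intro z hz
  refine DifferentiableAt.differentiableWithinAt ?_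
  have hc : ContinuousAt f z := (hf.differentiableAt (hU.mem_nhds hz)).continuousAt
  obtain ⟨r, hr, hrU⟩ : ∃ r > 0, Metric.ball z r ⊆ U ∩ {w | ‖f w‖ < ‖f z‖ + 1} :=
    Metric.mem_nhds_iff.mp (inter_mem (hU.mem_nhds hz)
      (hc.norm.eventually (gt_mem_nhds (lt_add_one _))))
  set M := ‖f z‖ + 1
  have hball : ∀ w ∈ Metric.ball z (r / 2), ∀ u, ‖u‖ < r / 2 → w + u ∈ Metric.ball z r := by
    intro w hw u hu
    rw [Metric.mem_ball, dist_eq_norm] at *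
    have := norm_add_le (w - z) u
    rw [show w + u - z = w - z + u by abel]
    linarith
  have hk : Tendsto (fun k : ℕ => ((k : ℂ) + 1)⁻¹) atTop (𝓝 0) := by
    simpa using tendsto_one_div_add_atTop_nhds_zero_nat (𝕜 := ℂ)
  have hkv : ∀ᶠ k : ℕ in atTop, ‖((k : ℂ) + 1)⁻¹ • v‖ < r / 2 := by
    have : Tendsto (fun k : ℕ => ‖((k : ℂ) + 1)⁻¹ • v‖) atTop (𝓝 0) := by
      simpa using (hk.smul_const v).norm
    exact this.eventually (gt_mem_nhds (by positivity))
  have hk0 : ∀ k : ℕ, ((k : ℂ) + 1) ≠ 0 := fun k => by exact_mod_cast k.succ_ne_zero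
  -- The directional derivative is the pointwise limit of difference quotients with step 1 / (k +
  -- 1). They are uniformly bounded by Schwarz's lemma on balls of radius r / 2, where f varies by
  -- at most 2M.
  refine differentiableAt_of_tendsto (r := r / 2)
    (f := fun k w => ((k : ℂ) + 1) * (f (w + ((k : ℂ) + 1)⁻¹ • v) - f w))
    (M := 2 * M / (r / 2) * ‖v‖) (by positivity) ?_ ?_
  · filter_upwards [hkv] with k hkv
    have hm : Set.MapsTo (fun w => w + ((k : ℂ) + 1)⁻¹ • v) (Metric.ball z (r / 2)) U :=
      fun w hw => (hrU (hball w hw _ hkv)).1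
    refine ⟨?_, fun w hw => ?_⟩
    · refine DifferentiableOn.const_mul (DifferentiableOn.sub (hf.comp (by fun_prop) hm)
        (hf.mono fun w hw => (hrU (Metric.ball_subset_ball (by linarith) hw)).1)) _
    · have h1 := Complex.dist_le_div_mul_dist_of_mapsTo_ball (f := f) (c := w) (R₁ := r / 2)
        (R₂ := 2 * M) (z := w + ((k : ℂ) + 1)⁻¹ • v) (hf.mono ?_) ?_ ?_
      · rw [norm_mul, ← dist_eq_norm]
        rw [dist_self_add_left, norm_smul, norm_inv] at h1
        have h0 : 0 < ‖(k : ℂ) + 1‖ := norm_pos_iff.mpr (hk0 k)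
        calc _ ≤ ‖(k : ℂ) + 1‖ * (2 * M / (r / 2) * (‖(k : ℂ) + 1‖⁻¹ * ‖v‖)) := by gcongr
          _ = _ := by field_simp
      · intro u hu
        have := hball w hw (u - w) (by simpa [dist_eq_norm] using hu)
        exact (hrU (by simpa using this)).1
      · intro u hu
        have h1 := hball w hw (u - w) (by simpa [dist_eq_norm] using hu)
        have h2 := (hrU (by simpa using h1 : u ∈ Metric.ball z r)).2
        have h3 := (hrU (Metric.ball_subset_ball (by linarith) hw : w ∈ Metric.ball z r)).2
        simp only [Set.mem_ofPred_eq] at h2 h3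
        rw [Metric.mem_closedBall, dist_eq_norm]
        linarith [norm_sub_le (f u) (f w)]
      · simpa using hkv
  · intro w hw
    have hw' : DifferentiableAt ℂ f w := hf.differentiableAt (hU.mem_nhds
      (hrU (Metric.ball_subset_ball (by linarith) hw)).1)
    have h1 := (hw'.hasFDerivAt.hasLineDerivAt v).tendsto_slope_zero
    have h2 : Tendsto (fun k : ℕ => ((k : ℂ) + 1)⁻¹) atTop (𝓝[≠] 0) :=
      tendsto_nhdsWithin_iff.mpr ⟨hk, Eventually.of_forall fun k => inv_ne_zero (hk0 k)⟩
    refine (h1.comp h2).congr fun k => ?_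
    simp

end ComplexAnalysis

/-! ### Taylor coefficients along complex lines -/

section TaylorCoefficients

lemma differentiableOn_slice {E : Type*} [NormedAddCommGroup E] [NormedSpace ℂ E] {f : E → ℂ}
    {U : Set E} (hf : DifferentiableOn ℂ f U) (y v : E) {s : Set ℂ} (hs : ∀ t ∈ s, y + t • v ∈ U) :
    DifferentiableOn ℂ (fun t : ℂ => f (y + t • v)) s :=
  hf.comp (f := fun t : ℂ => y + t • v) (by fun_prop) hs

lemma analyticAt_slice_zero {E : Type*} [NormedAddCommGroup E] [NormedSpace ℂ E] {f : E → ℂ}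
    {U : Set E} (hU : IsOpen U) (h0 : (0 : E) ∈ U) (hf : DifferentiableOn ℂ f U) (z : E) :
    AnalyticAt ℂ (fun t : ℂ => f (t • z)) 0 := by
  have hV : IsOpen ((fun t : ℂ => t • z) ⁻¹' U) := hU.preimage (by fun_prop)
  refine DifferentiableOn.analyticAt (s := (fun t : ℂ => t • z) ⁻¹' U) ?_
    (hV.mem_nhds (by simpa using h0))
  simpa using differentiableOn_slice hf 0 z (s := (fun t : ℂ => t • z) ⁻¹' U)
    (fun t ht => by simpa using ht)

/-- The Taylor coefficients of the restrictions of a holomorphic function to complex lines through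
the origin are homogeneous polynomials. -/
lemma exists_isHomogeneous_iteratedDeriv {n : ℕ} {U : Set (Fin n → ℂ)} (hU : IsOpen U)
    (h0 : (0 : Fin n → ℂ) ∈ U) (d : ℕ) {f : (Fin n → ℂ) → ℂ} (hf : DifferentiableOn ℂ f U) :
    ∃ P : MvPolynomial (Fin n) ℂ, P.IsHomogeneous d ∧
      ∀ z, iteratedDeriv d (fun t : ℂ => f (t • z)) 0 = MvPolynomial.eval z P := by
  induction d generalizing f with
  | zero => exact ⟨MvPolynomial.C (f 0), MvPolynomial.isHomogeneous_C _ _, fun z => by simp⟩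
  | succ d ih =>
    -- By the chain rule d/dt f(tz) = ∑ zᵢ (∂ᵢf)(tz), so the polynomial of degree d + 1 for f is ∑
    -- Xᵢ Pᵢ, with Pᵢ the one of degree d for ∂ᵢf.
    choose P hP hPe using fun i : Fin n => ih (hf.fderiv_apply hU (Pi.single i 1))
    refine ⟨∑ i, MvPolynomial.X i * P i, ?_, fun z => ?_⟩
    · refine MvPolynomial.IsHomogeneous.sum _ _ _ fun i _ => ?_
      rw [add_comm]
      exact (MvPolynomial.isHomogeneous_X _ i).mul (hP i)
    · have hV : IsOpen ((fun t : ℂ => t • z) ⁻¹' U) := hU.preimage (by fun_prop)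
      have hd : deriv (fun t : ℂ => f (t • z)) =ᶠ[𝓝 0]
          fun t => ∑ i, z i * fderiv ℂ f (t • z) (Pi.single i 1) := by
        filter_upwards [hV.mem_nhds (by simpa using h0)] with t ht
        have h1 : HasFDerivAt f (fderiv ℂ f (t • z)) (t • z) :=
          (hf.differentiableAt (hU.mem_nhds ht)).hasFDerivAt
        have h2 : HasDerivAt (fun t : ℂ => t • z) z t := by
          simpa using (hasDerivAt_id t).smul_const z
        rw [show deriv (fun t : ℂ => f (t • z)) t = _ from (h1.comp_hasDerivAt t h2).deriv]
        rw [show fderiv ℂ f (t • z) z = fderiv ℂ f (t • z) (∑ i, Pi.single i (z i)) by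
          rw [Finset.univ_sum_single], map_sum]
        refine Finset.sum_congr rfl fun i _ => ?_
        rw [← smul_eq_mul, ← map_smul, ← Pi.single_smul, smul_eq_mul, mul_one]
      rw [iteratedDeriv_succ', hd.iteratedDeriv_eq, iteratedDeriv_fun_sum]
      · simp only [map_sum, map_mul, MvPolynomial.eval_X, ← hPe]
        refine Finset.sum_congr rfl fun i _ => ?_
        rw [iteratedDeriv_const_mul_field]
      · intro i _
        exact contDiffAt_const.mul
          (analyticAt_slice_zero hU h0 (hf.fderiv_apply hU (Pi.single i 1)) z).contDiffAt

/-- Cauchy's formula; the angular measure dθ / 2π = dc / (2πic) supplies the missing factor c⁻¹. -/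
lemma circleAverage_inv_pow_mul {g : ℂ → ℂ} (hg : DifferentiableOn ℂ g (Metric.closedBall 0 1))
    (d : ℕ) :
    Real.circleAverage (fun c => (c ^ d)⁻¹ * g c) 0 1 = (d.factorial : ℂ)⁻¹ * iteratedDeriv d g 0 := by
  rw [Real.circleAverage_eq_circleIntegral one_ne_zero]
  have := hg.circleIntegral_one_div_sub_center_pow_smul one_pos d
  simp only [sub_zero, smul_eq_mul, one_div] at this ⊢
  simp only [← mul_assoc, ← mul_inv, ← pow_succ']
  rw [this]
  have h : (2 * (Real.pi : ℂ) * Complex.I) ≠ 0 := Complex.two_pi_I_ne_zero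
  field_simp

end TaylorCoefficients

/-! ### Averaging over rotations -/

section CircularAveraging

lemma measurePreserving_unit_smul {n : ℕ} {c : ℂ} (hc : ‖c‖ = 1) :
    MeasurePreserving (fun z : Fin n → ℂ => c • z) volume volume := by
  let e : ℂ ≃ₗᵢ[ℝ] ℂ := rotation ⟨c, by simpa [Submonoid.unitSphere] using hc⟩
  exact volume_preserving_pi (fun _ : Fin n => e.measurePreserving)

variable {n : ℕ} {F : Type*} [NormedAddCommGroup F] [NormedSpace ℝ F] [CompleteSpace F]

/-- Averaging over the circles `{c • u | ‖c‖ = 1}` does not change the integral over a set that is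
invariant under rotations. -/
lemma integrableOn_circleAverage_and_setIntegral {B : Set (Fin n → ℂ)} (hBm : MeasurableSet B)
    (hB : ∀ c : ℂ, ‖c‖ = 1 → ∀ z ∈ B, c • z ∈ B) {g : (Fin n → ℂ) → F} (hg : IntegrableOn g B) :
    IntegrableOn (fun u => Real.circleAverage (fun c => g (c • u)) 0 1) B ∧
      ∫ u in B, Real.circleAverage (fun c => g (c • u)) 0 1 = ∫ u in B, g u := by
  set μ : Measure (Fin n → ℂ) := volume.restrict B
  set ν : Measure ℝ := volume.restrict (Set.Ioc 0 (2 * Real.pi))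
  have hpre : ∀ c : ℂ, ‖c‖ = 1 → (fun z : Fin n → ℂ => c • z) ⁻¹' B = B := by
    intro c hc
    ext z
    refine ⟨fun hz => ?_, hB c hc z⟩
    have := hB c⁻¹ (by simp [hc]) _ hz
    rwa [inv_smul_smul₀ (by rintro rfl; simp at hc)] at this
  have hmp : ∀ θ : ℝ, Measure.map (fun u : Fin n → ℂ => circleMap 0 1 θ • u) μ = μ := by
    intro θ
    have h1 : ‖circleMap 0 1 θ‖ = 1 := by simp
    have := (measurePreserving_unit_smul (n := n) h1).restrict_preimage hBm
    rw [hpre _ h1] at this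
    exact this.map_eq
  -- The shear (θ, u) ↦ (θ, e^{iθ} u) preserves the product measure, which gives the joint
  -- integrability needed for Fubini from integrability of g alone.
  have hT : MeasurePreserving (fun p : ℝ × (Fin n → ℂ) => (p.1, circleMap 0 1 p.1 • p.2))
      (ν.prod μ) (ν.prod μ) := by
    refine (MeasurePreserving.id ν).skew_product (g := fun θ u => circleMap 0 1 θ • u) ?_
      (ae_of_all _ hmp)
    have : Continuous (Function.uncurry fun (θ : ℝ) (u : Fin n → ℂ) => circleMap 0 1 θ • u) := by
      simp only [Function.uncurry_def]
      fun_prop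
    exact this.measurable
  have hI : Integrable (fun p : ℝ × (Fin n → ℂ) => g (circleMap 0 1 p.1 • p.2)) (ν.prod μ) :=
    hT.integrable_comp_of_integrable (g := fun p : ℝ × (Fin n → ℂ) => g p.2) (hg.comp_snd ν)
  have hca : (fun u => Real.circleAverage (fun c => g (c • u)) 0 1) =
      fun u => (2 * Real.pi)⁻¹ • ∫ θ, g (circleMap 0 1 θ • u) ∂ν := by
    funext u
    rw [Real.circleAverage_def, intervalIntegral.integral_of_le Real.two_pi_pos.le]
  rw [hca]
  refine ⟨hI.integral_prod_right.smul _, ?_⟩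
  rw [integral_smul, integral_integral_swap (f := fun u θ => g (circleMap 0 1 θ • u)) hI.swap]
  have : ∀ θ : ℝ, ∫ u, g (circleMap 0 1 θ • u) ∂μ = ∫ u, g u ∂μ := by
    intro θ
    have hh : MeasurePreserving (fun u : Fin n → ℂ => circleMap 0 1 θ • u) μ μ :=
      ⟨by fun_prop, hmp θ⟩
    have hne : circleMap 0 1 θ ≠ 0 := by
      have : ‖circleMap 0 1 θ‖ = 1 := by simp
      intro h; rw [h] at this; simp at this
    exact hh.integral_comp (Homeomorph.smulOfNeZero _ hne).measurableEmbedding g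
  simp only [this, integral_const, ν, measureReal_restrict_apply_univ, Real.volume_real_Ioc,
    sub_zero, smul_smul]
  rw [max_eq_left Real.two_pi_pos.le, inv_mul_cancel₀ Real.two_pi_pos.ne', one_smul]

end CircularAveraging

/-! ### Point evaluations and completeness of the Bergman space -/

section BergmanSpace

variable {n : ℕ}

lemma add_smul_mem_ball {z u : Fin n → ℂ} {r : ℝ} (hu : u ∈ Metric.ball (0 : Fin n → ℂ) r) {c : ℂ}
    (hc : ‖c‖ ≤ 1) : z + c • u ∈ Metric.ball z r := by
  rw [mem_ball_zero_iff] at hu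
  rw [mem_ball_iff_norm, add_sub_cancel_left, norm_smul]
  exact (mul_le_of_le_one_left (norm_nonneg _) hc).trans_lt hu

lemma setIntegral_ball_eq_translate {F : Type*} [NormedAddCommGroup F] [NormedSpace ℝ F]
    (g : (Fin n → ℂ) → F) (z : Fin n → ℂ) (r : ℝ) :
    ∫ u in Metric.ball 0 r, g (z + u) = ∫ w in Metric.ball z r, g w := by
  rw [← (measurePreserving_add_left volume z).setIntegral_preimage_emb
    (measurableEmbedding_addLeft z) g (Metric.ball z r)]
  simp

lemma integrableOn_ball_translate {F : Type*} [NormedAddCommGroup F]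
    {g : (Fin n → ℂ) → F} {z : Fin n → ℂ} {r : ℝ} (hg : IntegrableOn g (Metric.ball z r)) :
    IntegrableOn (fun u => g (z + u)) (Metric.ball 0 r) := by
  have := ((measurePreserving_add_left volume z).integrableOn_comp_preimage
    (measurableEmbedding_addLeft z) (f := g) (s := Metric.ball z r)).mpr hg
  simpa [Function.comp_def] using this

/-- The mean value property of holomorphic functions on polydiscs. -/
lemma setIntegral_ball_eq_of_differentiableOn {f : (Fin n → ℂ) → ℂ} {z : Fin n → ℂ} {r : ℝ}
    (hf : DifferentiableOn ℂ f (Metric.ball z r)) (hi : IntegrableOn f (Metric.ball z r)) :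
    ∫ w in Metric.ball z r, f w = volume.real (Metric.ball (0 : Fin n → ℂ) r) * f z := by
  rw [← setIntegral_ball_eq_translate, ← (integrableOn_circleAverage_and_setIntegral
    Metric.isOpen_ball.measurableSet (fun c hc u hu => by simpa [norm_smul, hc] using hu)
    (integrableOn_ball_translate hi)).2]
  -- After averaging over rotations about z, only the one-variable mean value property on each disc
  -- z + cu is needed.
  have : ∀ u ∈ Metric.ball (0 : Fin n → ℂ) r,
      Real.circleAverage (fun c : ℂ => f (z + c • u)) 0 1 = f z := by
    intro u hu
    have hd : DifferentiableOn ℂ (fun c : ℂ => f (z + c • u)) (Metric.closedBall 0 1) :=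
      differentiableOn_slice hf z u fun c hc => add_smul_mem_ball hu (by simpa using hc)
    have := DiffContOnCl.circleAverage (f := fun c : ℂ => f (z + c • u)) (c := 0) (R := 1)
      (DifferentiableOn.diffContOnCl (by simpa [closure_ball] using hd))
    simpa using this
  rw [setIntegral_congr_fun Metric.isOpen_ball.measurableSet this, setIntegral_const,
    Complex.real_smul]

/-- Point evaluations on the Bergman space are represented by inner products with elements of
`L²(D)`, with norm control in terms of the distance to the boundary. -/
lemma exists_inner_eq_apply {r : ℝ} (hr : 0 < r) : ∃ C : ℝ, ∀ (D : Set (Fin n → ℂ)) (z : Fin n → ℂ),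
    Metric.ball z r ⊆ D → ∃ k : Lp ℂ 2 (volume.restrict D), ‖k‖ ≤ C ∧
      ∀ (g : Lp ℂ 2 (volume.restrict D)) (f : (Fin n → ℂ) → ℂ), IsL2h D f →
        g =ᵐ[volume.restrict D] f → inner ℂ k g = f z := by
  set V : ℝ := volume.real (Metric.ball (0 : Fin n → ℂ) r)
  have hV : 0 < V := ENNReal.toReal_pos (Metric.measure_ball_pos _ _ hr).ne' measure_ball_lt_top.ne
  -- The representing element is V⁻¹ times the indicator of the ball. Its norm depends on r alone,
  -- by translation invariance, and not on D or z.
  refine ⟨V⁻¹ * V ^ (1 / 2 : ℝ), fun D z hz => ?_⟩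
  have hm : (volume.restrict D) (Metric.ball z r) = volume (Metric.ball z r) := by
    rw [Measure.restrict_apply measurableSet_ball, Set.inter_eq_left.mpr hz]
  have hV' : volume.real (Metric.ball z r) = V := by
    simp only [V, measureReal_def]
    rw [Measure.addHaar_ball_center]
  have hfin : (volume.restrict D) (Metric.ball z r) ≠ ∞ := by
    rw [hm]; exact measure_ball_lt_top.ne
  refine ⟨((V : ℂ)⁻¹) • indicatorConstLp 2 measurableSet_ball hfin 1, ?_, fun g f hf hgf => ?_⟩
  · rw [norm_smul, norm_indicatorConstLp (by norm_num) (by norm_num), norm_inv, norm_one, one_mul,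
      Complex.norm_real, Real.norm_of_nonneg hV.le, measureReal_def, hm, ← measureReal_def, hV']
    simp
  · rw [inner_smul_left, L2.inner_indicatorConstLp_one, Measure.restrict_restrict measurableSet_ball,
      Set.inter_eq_left.mpr hz]
    have h1 : ∫ x in Metric.ball z r, g x = ∫ x in Metric.ball z r, f x :=
      integral_congr_ae (ae_restrict_of_ae_restrict_of_subset hz hgf)
    have h2 : IntegrableOn f (Metric.ball z r) := by
      have hmem : MemLp f 2 (volume.restrict (Metric.ball z r)) :=
        hf.memLp.mono_measure (Measure.restrict_mono hz le_rfl)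
      have : IsFiniteMeasure (volume.restrict (Metric.ball z r)) :=
        ⟨by simpa using measure_ball_lt_top⟩
      exact hmem.integrable (by norm_num)
    rw [h1, setIntegral_ball_eq_of_differentiableOn (hf.differentiableOn.mono hz) h2, map_inv₀,
      Complex.conj_ofReal]
    have : (V : ℂ) ≠ 0 := by exact_mod_cast hV.ne'
    field_simp
    rfl

/-- Bounded point evaluations turn L² convergence into pointwise convergence with local uniform
bounds, so the pointwise limit is holomorphic; an a.e. convergent subsequence identifies it with the
L² limit. -/
lemma isClosed_bergmanSpace {D : Set (Fin n → ℂ)} (hD : IsOpen D) :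
    IsClosed (bergmanSpace D : Set (Lp ℂ 2 (volume.restrict D))) := by
  refine isClosed_of_closure_subset fun g hg => ?_
  obtain ⟨G, hG, hGg⟩ := mem_closure_iff_seq_limit.mp hg
  choose f hf hGf using hG
  obtain ⟨B, hB⟩ := hGg.norm.bddAbove_range
  have hB' : ∀ k, ‖G k‖ ≤ B := fun k => hB ⟨k, rfl⟩
  have hloc : ∀ z ∈ D, ∃ r > 0, ∃ M, (∀ k, ∀ w ∈ Metric.ball z r, w ∈ D ∧ ‖f k w‖ ≤ M) ∧
      ∀ w ∈ Metric.ball z r, ∃ l, Tendsto (fun k => f k w) atTop (𝓝 l) := by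
    intro z hz
    obtain ⟨r, hr, hrD⟩ := Metric.isOpen_iff.mp hD z hz
    obtain ⟨C, hC⟩ := exists_inner_eq_apply (n := n) (half_pos hr)
    have hsub : ∀ w ∈ Metric.ball z (r / 2), Metric.ball w (r / 2) ⊆ D := fun w hw =>
      (Metric.ball_subset_ball' (by linarith [Metric.mem_ball.mp hw])).trans hrD
    refine ⟨r / 2, half_pos hr, C * B, fun k w hw => ⟨hsub w hw (Metric.mem_ball_self (half_pos hr)),
      ?_⟩, fun w hw => ?_⟩
    · obtain ⟨K, hK, hKe⟩ := hC D w (hsub w hw)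
      rw [← hKe _ _ (hf k) (hGf k)]
      exact (norm_inner_le_norm _ _).trans
        (mul_le_mul hK (hB' k) (norm_nonneg _) ((norm_nonneg _).trans hK))
    · obtain ⟨K, hK, hKe⟩ := hC D w (hsub w hw)
      refine ⟨inner ℂ K g, ?_⟩
      simp_rw [← fun k => hKe _ _ (hf k) (hGf k)]
      exact tendsto_const_nhds.inner hGg
  have hlim : ∀ z ∈ D, Tendsto (fun k => f k z) atTop (𝓝 (limUnder atTop fun k => f k z)) := by
    intro z hz
    obtain ⟨r, hr, M, -, h⟩ := hloc z hz
    exact tendsto_nhds_limUnder (h z (Metric.mem_ball_self hr))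
  have hae : g =ᵐ[volume.restrict D] fun z => limUnder atTop fun k => f k z := by
    obtain ⟨ns, hns, hnst⟩ := (tendstoInMeasure_of_tendsto_Lp hGg).exists_seq_tendsto_ae
    filter_upwards [hnst, ae_all_iff.mpr hGf, ae_restrict_mem hD.measurableSet] with z h1 h2 hz
    simp only [h2] at h1
    exact tendsto_nhds_unique h1 ((hlim z hz).comp hns.tendsto_atTop)
  refine ⟨_, ⟨fun z hz => ?_, (Lp.memLp g).ae_eq hae⟩, hae⟩
  obtain ⟨r, hr, M, h, -⟩ := hloc z hz
  refine (differentiableAt_of_tendsto (f := f) hr (M := M) (Eventually.of_forall fun k => ⟨?_, ?_⟩)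
    (fun w hw => hlim w (h 0 w hw).1)).differentiableWithinAt
  · exact (hf k).differentiableOn.mono fun w hw => (h k w hw).1
  · exact fun w hw => (h k w hw).2

lemma completeSpace_bergmanSpace {D : Set (Fin n → ℂ)} (hD : IsOpen D) :
    CompleteSpace (bergmanSpace D) :=
  (isClosed_bergmanSpace hD).completeSpace_coe

end BergmanSpace

/-! ### Balanced domains -/

section BalancedDomain

variable {n : ℕ} {h : (Fin n → ℂ) → ℝ}

namespace IsBalancedFunction

lemma isOpen (hh : IsBalancedFunction h) : IsOpen (balancedDomain h) :=
  hh.upperSemicontinuous.isOpen_preimage 1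

lemma smul_mem (hh : IsBalancedFunction h) {z : Fin n → ℂ} (hz : z ∈ balancedDomain h) {c : ℂ}
    (hc : ‖c‖ ≤ 1) : c • z ∈ balancedDomain h := by
  change h (c • z) < 1
  rw [hh.homogeneous]
  exact (mul_le_of_le_one_left (hh.nonneg z) hc).trans_lt hz

lemma apply_zero (hh : IsBalancedFunction h) : h 0 = 0 := by
  simpa using hh.homogeneous 0 0

lemma zero_mem (hh : IsBalancedFunction h) : (0 : Fin n → ℂ) ∈ balancedDomain h := by
  change h 0 < 1
  rw [hh.apply_zero]; exact one_pos

lemma isConnected (hh : IsBalancedFunction h) : IsConnected (balancedDomain h) := by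
  have hs : StarConvex ℝ 0 (balancedDomain h) := by
    rw [starConvex_zero_iff]
    intro x hx a ha0 ha1
    have := hh.smul_mem hx (c := (a : ℂ)) (by simpa [abs_of_nonneg ha0] using ha1)
    rwa [Complex.coe_smul] at this
  exact (hs.isPathConnected hh.zero_mem).isConnected

/-- The room R > 1 places t = 1 inside the disc on which the Taylor series of t ↦ f(tz) converges.
-/
lemma exists_smul_mem (hh : IsBalancedFunction h) {z : Fin n → ℂ} (hz : z ∈ balancedDomain h) :
    ∃ R > 1, ∀ t ∈ Metric.ball (0 : ℂ) R, t • z ∈ balancedDomain h := by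
  have hz' : h z < 1 := hz
  obtain ⟨R, h1, h2⟩ : ∃ R > (1 : ℝ), R * h z < 1 := by
    have hc : ContinuousAt (fun R : ℝ => R * h z) 1 := by fun_prop
    have := hc.eventually (gt_mem_nhds (by simpa using hz'))
    obtain ⟨R, hR, hR1⟩ := ((this.filter_mono nhdsWithin_le_nhds).and
      (self_mem_nhdsWithin (a := (1 : ℝ)) (s := Set.Ioi 1))).exists
    exact ⟨R, hR1, hR⟩
  refine ⟨R, h1, fun t ht => ?_⟩
  change h (t • z) < 1
  rw [hh.homogeneous]
  rw [mem_ball_zero_iff] at ht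
  exact (mul_le_mul_of_nonneg_right ht.le (hh.nonneg z)).trans_lt h2

end IsBalancedFunction

end BalancedDomain

lemma MvPolynomial.IsHomogeneous.eval_smul {σ R : Type*} [Fintype σ] [CommSemiring R]
    {P : MvPolynomial σ R} {d : ℕ} (hP : P.IsHomogeneous d) (c : R) (z : σ → R) :
    MvPolynomial.eval (c • z) P = c ^ d * MvPolynomial.eval z P := by
  rw [MvPolynomial.eval_eq', MvPolynomial.eval_eq', Finset.mul_sum]
  refine Finset.sum_congr rfl fun s hs => ?_
  have hsd : ∑ i, s i = d := by
    rw [hP.degree_eq_sum_deg_support hs]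
    exact (Finsupp.sum_fintype s (fun _ k => k) (fun _ => rfl)).symm
  simp only [Pi.smul_apply, smul_eq_mul, mul_pow, Finset.prod_mul_distrib, Finset.prod_pow_eq_pow_sum,
    hsd]
  ring

/-! ### Homogeneous components of square integrable functions -/

section CircleAverages

lemma norm_circleAverage_le_circleAverage_norm {F : Type*} [NormedAddCommGroup F] [NormedSpace ℝ F]
    (f : ℂ → F) (c : ℂ) (R : ℝ) :
    ‖Real.circleAverage f c R‖ ≤ Real.circleAverage (fun z => ‖f z‖) c R := by
  rw [Real.circleAverage_def, Real.circleAverage_def, norm_smul,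
    Real.norm_of_nonneg (by positivity), smul_eq_mul]
  gcongr
  exact intervalIntegral.norm_integral_le_integral_norm Real.two_pi_pos.le

/-- Average the inequality φ² ≥ 2mφ − m², where m is the mean of φ. -/
lemma sq_circleAverage_le {φ : ℂ → ℝ} {c : ℂ} {R : ℝ} (hφ : ContinuousOn φ (Metric.sphere c |R|)) :
    Real.circleAverage φ c R ^ 2 ≤ Real.circleAverage (fun z => φ z ^ 2) c R := by
  set m := Real.circleAverage φ c R
  have h1 : CircleIntegrable φ c R := hφ.circleIntegrable'
  have h2 : CircleIntegrable (fun z => φ z ^ 2) c R := (hφ.pow 2).circleIntegrable'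
  have h3 : CircleIntegrable (fun z => (2 * m) • φ z - m ^ 2) c R :=
    ((hφ.const_smul (2 * m)).sub continuousOn_const).circleIntegrable'
  have h4 := Real.circleAverage_mono h3 h2 (fun z _ => by
    simp only [smul_eq_mul]; nlinarith [sq_nonneg (φ z - m)])
  rw [Real.circleAverage_fun_sub (f₁ := fun z => (2 * m) • φ z) (f₂ := fun _ => m ^ 2)
    (hφ.const_smul (2 * m)).circleIntegrable' continuousOn_const.circleIntegrable', Real.circleAverage_fun_smul,
    Real.circleAverage_const] at h4
  simp only [smul_eq_mul] at h4
  change 2 * m * m - m ^ 2 ≤ _ at h4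
  linarith

end CircleAverages

section HomogeneousExpansion

variable {n : ℕ} {h : (Fin n → ℂ) → ℝ}

lemma IsBalancedFunction.differentiableOn_smul (hh : IsBalancedFunction h)
    {f : (Fin n → ℂ) → ℂ} (hf : DifferentiableOn ℂ f (balancedDomain h)) {z : Fin n → ℂ}
    (hz : z ∈ balancedDomain h) :
    DifferentiableOn ℂ (fun t : ℂ => f (t • z)) (Metric.closedBall 0 1) := by
  simpa using differentiableOn_slice hf 0 z (s := Metric.closedBall 0 1)
    fun t ht => by simpa using hh.smul_mem hz (by simpa using ht)

/-- The homogeneous components of a function in `L²_h(D)` lie in `L²_h(D)`. -/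
lemma IsL2h.memLp_iteratedDeriv (hh : IsBalancedFunction h) {f : (Fin n → ℂ) → ℂ}
    (hf : IsL2h (balancedDomain h) f) (d : ℕ) :
    MemLp (fun z => (d.factorial : ℂ)⁻¹ * iteratedDeriv d (fun t : ℂ => f (t • z)) 0) 2
      (volume.restrict (balancedDomain h)) := by
  obtain ⟨P, -, hP⟩ := exists_isHomogeneous_iteratedDeriv hh.isOpen hh.zero_mem d hf.differentiableOn
  have hm : AEStronglyMeasurable
      (fun z => (d.factorial : ℂ)⁻¹ * iteratedDeriv d (fun t : ℂ => f (t • z)) 0)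
      (volume.restrict (balancedDomain h)) := by
    simp_rw [hP]
    exact (continuous_const.mul (MvPolynomial.continuous_eval P)).aestronglyMeasurable
  refine (memLp_two_iff_integrable_sq_norm hm).mpr ?_
  have hfi : IntegrableOn (fun z => ‖f z‖ ^ 2) (balancedDomain h) :=
    (memLp_two_iff_integrable_sq_norm hf.memLp.1).mp hf.memLp
  -- By Cauchy's formula and Jensen's inequality, the squared component at z is at most the average
  -- of |f(cz)|², which is integrable by rotation invariance.
  refine Integrable.mono' (integrableOn_circleAverage_and_setIntegral hh.isOpen.measurableSet
    (fun c hc z hz => hh.smul_mem hz hc.le) hfi).1 (hm.norm.pow 2) ?_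
  filter_upwards [ae_restrict_mem hh.isOpen.measurableSet] with z hz
  have hd := hh.differentiableOn_smul hf.differentiableOn hz
  rw [← circleAverage_inv_pow_mul hd, norm_pow, norm_norm]
  have h1 := norm_circleAverage_le_circleAverage_norm (fun c : ℂ => (c ^ d)⁻¹ * f (c • z)) 0 1
  have h2 : Real.circleAverage (fun c : ℂ => ‖(c ^ d)⁻¹ * f (c • z)‖) 0 1 =
      Real.circleAverage (fun c : ℂ => ‖f (c • z)‖) 0 1 := by
    refine Real.circleAverage_congr_sphere fun c hc => ?_
    have : ‖c‖ = 1 := by simpa using hc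
    simp [this]
  rw [h2] at h1
  refine (pow_le_pow_left₀ (norm_nonneg _) h1 2).trans (sq_circleAverage_le ?_)
  rw [abs_one]
  exact (hd.continuousOn.mono Metric.sphere_subset_closedBall).norm

/-- The inner product of a homogeneous polynomial of degree `d` with `f` only sees the homogeneous
component of degree `d` of `f`. -/
lemma IsL2h.setIntegral_conj_eval_mul (hh : IsBalancedFunction h) {f : (Fin n → ℂ) → ℂ}
    (hf : IsL2h (balancedDomain h) f) {d : ℕ} {P : MvPolynomial (Fin n) ℂ} (hP : P.IsHomogeneous d)
    (hPm : MemLp (fun z => MvPolynomial.eval z P) 2 (volume.restrict (balancedDomain h))) :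
    ∫ z in balancedDomain h, starRingEnd ℂ (MvPolynomial.eval z P) * f z =
      ∫ z in balancedDomain h, starRingEnd ℂ (MvPolynomial.eval z P) *
        ((d.factorial : ℂ)⁻¹ * iteratedDeriv d (fun t : ℂ => f (t • z)) 0) := by
  have hi : IntegrableOn (fun z => starRingEnd ℂ (MvPolynomial.eval z P) * f z)
      (balancedDomain h) := hPm.star.integrable_mul hf.memLp
  rw [← (integrableOn_circleAverage_and_setIntegral hh.isOpen.measurableSet
    (fun c hc z hz => hh.smul_mem hz hc.le) hi).2]
  refine setIntegral_congr_fun hh.isOpen.measurableSet fun z hz => ?_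
  have hd := hh.differentiableOn_smul hf.differentiableOn hz
  rw [← circleAverage_inv_pow_mul hd, ← smul_eq_mul, ← Real.circleAverage_fun_smul]
  refine Real.circleAverage_congr_sphere fun c hc => ?_
  have hc1 : ‖c‖ = 1 := by simpa using hc
  have he : MvPolynomial.eval (c • z) P = c ^ d * MvPolynomial.eval z P := hP.eval_smul c z
  -- On the unit circle the conjugate of cᵈ is c⁻ᵈ, exactly the kernel extracting the component of
  -- degree d.
  rw [he, map_mul, map_pow, ← Complex.inv_eq_conj hc1, smul_eq_mul, inv_pow]
  ring

end HomogeneousExpansion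

/-! ### The homogeneous orthonormal basis -/

section HomogeneousBasis

variable {n : ℕ} {h : (Fin n → ℂ) → ℝ}

/-- The homogeneous polynomials of degree `d` that are square integrable on `D`. -/
def squareIntegrableHomogeneous (D : Set (Fin n → ℂ)) (d : ℕ) :
    Submodule ℂ (MvPolynomial (Fin n) ℂ) where
  carrier := {P | P.IsHomogeneous d ∧
    MemLp (fun z => MvPolynomial.eval z P) 2 (volume.restrict D)}
  zero_mem' := ⟨MvPolynomial.isHomogeneous_zero _ _ _, by simp⟩
  add_mem' := fun {P Q} hP hQ => ⟨hP.1.add hQ.1, by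
    have := hP.2.add hQ.2
    simpa [Pi.add_def] using this⟩
  smul_mem' := fun c P hP => ⟨Submodule.smul_mem (MvPolynomial.homogeneousSubmodule (Fin n) ℂ d) c
    hP.1, by
    have := hP.2.const_smul c
    simpa [Pi.smul_def, MvPolynomial.smul_eval] using this⟩

instance (D : Set (Fin n → ℂ)) (d : ℕ) : FiniteDimensional ℂ (squareIntegrableHomogeneous D d) := by
  have : FiniteDimensional ℂ (MvPolynomial.homogeneousSubmodule (Fin n) ℂ d) :=
    Module.Finite.iff_fg.mpr (MvPolynomial.homogeneousSubmodule_fg (Fin n) ℂ d)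
  exact Submodule.finiteDimensional_of_le
    (S₂ := MvPolynomial.homogeneousSubmodule (Fin n) ℂ d) fun P hP => hP.1

lemma differentiable_eval (P : MvPolynomial (Fin n) ℂ) :
    Differentiable ℂ fun z : Fin n → ℂ => MvPolynomial.eval z P := by
  simp_rw [MvPolynomial.eval_eq']
  fun_prop

lemma isL2h_eval {D : Set (Fin n → ℂ)} {P : MvPolynomial (Fin n) ℂ}
    (hP : MemLp (fun z => MvPolynomial.eval z P) 2 (volume.restrict D)) :
    IsL2h D fun z => MvPolynomial.eval z P :=
  ⟨(differentiable_eval P).differentiableOn, hP⟩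

/-- The embedding of the square integrable homogeneous polynomials into the Bergman space. -/
def toBergmanSpace (D : Set (Fin n → ℂ)) (d : ℕ) :
    squareIntegrableHomogeneous D d →ₗ[ℂ] bergmanSpace D where
  toFun P := ⟨P.2.2.toLp _, _, isL2h_eval P.2.2, P.2.2.coeFn_toLp⟩
  map_add' P Q := by
    refine Subtype.ext (Eq.trans ?_ (MemLp.toLp_add P.2.2 Q.2.2))
    exact MemLp.toLp_congr (P + Q).2.2 (P.2.2.add Q.2.2) (ae_of_all _ fun z => by simp)
  map_smul' c P := by
    refine Subtype.ext (Eq.trans ?_ (MemLp.toLp_const_smul c P.2.2))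
    exact MemLp.toLp_congr (c • P).2.2 (P.2.2.const_smul c)
      (ae_of_all _ fun z => by simp [MvPolynomial.smul_eval])

lemma inner_toBergmanSpace {D : Set (Fin n → ℂ)} {d : ℕ} (P : squareIntegrableHomogeneous D d)
    (g : bergmanSpace D) {f : (Fin n → ℂ) → ℂ} (hg : g =ᵐ[volume.restrict D] f) :
    inner ℂ (toBergmanSpace D d P : Lp ℂ 2 (volume.restrict D)) g =
      ∫ z in D, starRingEnd ℂ (MvPolynomial.eval z (P : MvPolynomial (Fin n) ℂ)) * f z := by
  rw [L2.inner_def]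
  refine integral_congr_ae ?_
  filter_upwards [P.2.2.coeFn_toLp, hg] with z h1 h2
  change inner ℂ ((P.2.2.toLp _ : Lp ℂ 2 (volume.restrict D)) z) _ = _
  rw [h1, h2, RCLike.inner_apply, mul_comm]

/-- The component of degree d of Q vanishes, because Q(tz) = tᵉ Q(z) and d ≠ e. -/
lemma IsBalancedFunction.inner_toBergmanSpace_eq_zero (hh : IsBalancedFunction h) {d e : ℕ}
    (hde : d ≠ e) (P : squareIntegrableHomogeneous (balancedDomain h) d)
    (Q : squareIntegrableHomogeneous (balancedDomain h) e) :
    inner ℂ (toBergmanSpace _ d P : Lp ℂ 2 (volume.restrict (balancedDomain h)))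
      (toBergmanSpace _ e Q) = 0 := by
  rw [inner_toBergmanSpace P (toBergmanSpace _ e Q) Q.2.2.coeFn_toLp,
    (isL2h_eval Q.2.2).setIntegral_conj_eval_mul hh P.2.1 P.2.2]
  have : ∀ z : Fin n → ℂ, iteratedDeriv d (fun t : ℂ =>
      MvPolynomial.eval (t • z) (Q : MvPolynomial (Fin n) ℂ)) 0 = 0 := by
    intro z
    simp_rw [Q.2.1.eval_smul, mul_comm _ (MvPolynomial.eval z _)]
    rw [iteratedDeriv_const_mul_field, iteratedDeriv_fun_pow_zero]
    simp [hde]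
  simp [this]

/-- An element of the Bergman space that is orthogonal to all homogeneous polynomials vanishes. -/
lemma IsBalancedFunction.eq_zero_of_forall_inner_toBergmanSpace (hh : IsBalancedFunction h)
    {g : bergmanSpace (balancedDomain h)}
    (hg : ∀ d P, inner ℂ (toBergmanSpace (balancedDomain h) d P :
      Lp ℂ 2 (volume.restrict (balancedDomain h))) g = 0) : g = 0 := by
  obtain ⟨f, hf, hgf⟩ := g.2
  have hcoef : ∀ d, ∀ z ∈ balancedDomain h, iteratedDeriv d (fun t : ℂ => f (t • z)) 0 = 0 := by
    intro d
    obtain ⟨P, hP, hPe⟩ :=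
      exists_isHomogeneous_iteratedDeriv hh.isOpen hh.zero_mem d hf.differentiableOn
    have hev : ∀ z, MvPolynomial.eval z ((d.factorial : ℂ)⁻¹ • P) =
        (d.factorial : ℂ)⁻¹ * iteratedDeriv d (fun t : ℂ => f (t • z)) 0 := fun z => by
      rw [MvPolynomial.smul_eval, hPe]
    have hQ : (d.factorial : ℂ)⁻¹ • P ∈ squareIntegrableHomogeneous (balancedDomain h) d :=
      ⟨Submodule.smul_mem (MvPolynomial.homogeneousSubmodule (Fin n) ℂ d) _ hP, by
        simp_rw [hev]; exact hf.memLp_iteratedDeriv hh d⟩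
    -- The component of f of degree d is itself a test polynomial, and its inner product with f is
    -- its own squared norm; hence it is zero.
    have h0 := hg d ⟨_, hQ⟩
    rw [inner_toBergmanSpace _ _ hgf, hf.setIntegral_conj_eval_mul hh hQ.1 hQ.2] at h0
    simp_rw [← hev] at h0
    rw [← inner_toBergmanSpace ⟨_, hQ⟩ (toBergmanSpace _ d ⟨_, hQ⟩) hQ.2.coeFn_toLp,
      inner_self_eq_zero] at h0
    have h1 : (fun z => MvPolynomial.eval z ((d.factorial : ℂ)⁻¹ • P))
        =ᵐ[volume.restrict (balancedDomain h)] 0 :=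
      hQ.2.coeFn_toLp.symm.trans
        ((Lp.eq_zero_iff_ae_eq_zero).mp h0)
    have h2 := Measure.eqOn_open_of_ae_eq h1 hh.isOpen
      (MvPolynomial.continuous_eval _).continuousOn continuousOn_const
    intro z hz
    have h3 := h2 hz
    simp only [hev, Pi.zero_apply, mul_eq_zero, inv_eq_zero] at h3
    exact h3.resolve_left (by exact_mod_cast d.factorial_ne_zero)
  have hf0 : ∀ z ∈ balancedDomain h, f z = 0 := by
    intro z hz
    obtain ⟨R, hR, hRz⟩ := hh.exists_smul_mem hz
    have hd : DifferentiableOn ℂ (fun t : ℂ => f (t • z)) (Metric.ball 0 R) := by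
      simpa using differentiableOn_slice hf.differentiableOn 0 z (s := Metric.ball 0 R)
        (by simpa using hRz)
    have := Complex.hasSum_taylorSeries_on_ball hd (z := 1) (by simpa using hR)
    simp only [hcoef _ z hz, smul_zero, one_smul] at this
    exact this.unique hasSum_zero
  ext1
  refine (Lp.eq_zero_iff_ae_eq_zero).mpr (hgf.trans ?_)
  filter_upwards [ae_restrict_mem hh.isOpen.measurableSet] with z hz using hf0 z hz

lemma exists_hilbertBasis_of_orthogonal {E : Type*} [NormedAddCommGroup E] [InnerProductSpace ℂ E]
    [CompleteSpace E] (H : ℕ → Submodule ℂ E) [∀ d, FiniteDimensional ℂ (H d)]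
    (hort : ∀ d e, d ≠ e → ∀ x ∈ H d, ∀ y ∈ H e, inner ℂ x y = 0)
    (htot : ∀ g, (∀ d, ∀ x ∈ H d, inner ℂ x g = 0) → g = 0) :
    ∃ (N : ℕ → ℕ) (b : HilbertBasis (Σ d, Fin (N d)) ℂ E), ∀ d j, b ⟨d, j⟩ ∈ H d := by
  let u : ∀ d, OrthonormalBasis (Fin (Module.finrank ℂ (H d))) ℂ (H d) :=
    fun d => stdOrthonormalBasis ℂ (H d)
  have hfam : OrthogonalFamily ℂ (fun d => H d) fun d => (H d).subtypeₗᵢ :=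
    OrthogonalFamily.of_pairwise fun d e hde => Submodule.isOrtho_iff_inner_eq.mpr (hort d e hde)
  have hon := hfam.orthonormal_sigma_orthonormal (v_family := fun d => u d)
    fun d => (u d).orthonormal
  have hspan : (Submodule.span ℂ (Set.range fun a : Σ d, Fin (Module.finrank ℂ (H d)) =>
      (H a.1).subtypeₗᵢ (u a.1 a.2)))ᗮ = ⊥ := by
    rw [Submodule.eq_bot_iff]
    intro g hg
    rw [Submodule.mem_orthogonal] at hg
    refine htot g fun d x hx => hg x ?_
    rw [← show _ = x from congrArg Subtype.val ((u d).sum_repr ⟨x, hx⟩), Submodule.coe_sum]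
    exact Submodule.sum_mem _ fun j _ => Submodule.smul_mem _ _
      (Submodule.subset_span ⟨⟨d, j⟩, rfl⟩)
  refine ⟨fun d => Module.finrank ℂ (H d), HilbertBasis.mkOfOrthogonalEqBot hon hspan,
    fun d j => ?_⟩
  rw [HilbertBasis.coe_mkOfOrthogonalEqBot]
  exact (u d j).2

theorem IsBalancedFunction.exists_isHomogeneousOrthonormalBasis (hh : IsBalancedFunction h) :
    ∃ (N : ℕ → ℕ) (P : ∀ d, Fin (N d) → MvPolynomial (Fin n) ℂ),
      IsHomogeneousOrthonormalBasis (balancedDomain h) N P := by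
  have : CompleteSpace (bergmanSpace (balancedDomain h)) := completeSpace_bergmanSpace hh.isOpen
  obtain ⟨N, b, hb⟩ := exists_hilbertBasis_of_orthogonal
    (fun d => LinearMap.range (toBergmanSpace (balancedDomain h) d))
    (by
      rintro d e hde _ ⟨P, rfl⟩ _ ⟨Q, rfl⟩
      exact hh.inner_toBergmanSpace_eq_zero hde P Q)
    (fun g hg => hh.eq_zero_of_forall_inner_toBergmanSpace fun d P => hg d _ ⟨P, rfl⟩)
  choose P hP using hb
  refine ⟨N, fun d j => P d j, fun d j => (P d j).2.1, b, fun d j => ?_⟩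
  rw [← hP]
  exact (P d j).2.2.coeFn_toLp

end HomogeneousBasis

/-! ### Homogeneity and regularization of h_BK -/

section HBK

variable {n : ℕ} {N : ℕ → ℕ} {P : ∀ d, Fin (N d) → MvPolynomial (Fin n) ℂ}

lemma hBK_smul (hP : ∀ d j, (P d j).IsHomogeneous d) (c : ℂ) (z : Fin n → ℂ) :
    hBK P (c • z) = ENNReal.ofReal ‖c‖ * hBK P z := by
  rw [hBK, hBK, ← ENNReal.limsup_const_mul_of_ne_top ENNReal.ofReal_ne_top]
  refine limsup_congr ?_
  -- At d = 0 the exponent 1 / (2d) is 0 by convention and the terms do not scale; the limsup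
  -- ignores this term.
  filter_upwards [eventually_ge_atTop 1] with d hd
  have h1 : ∑ j, ‖MvPolynomial.eval (c • z) (P d j)‖ ^ 2 =
      ‖c‖ ^ (2 * d) * ∑ j, ‖MvPolynomial.eval z (P d j)‖ ^ 2 := by
    rw [Finset.mul_sum]
    refine Finset.sum_congr rfl fun j _ => ?_
    rw [(hP d j).eval_smul, norm_mul, norm_pow]; ring
  have hd' : (2 * d : ℕ) ≠ 0 := by omega
  rw [h1, Real.mul_rpow (by positivity) (by positivity), ← ENNReal.ofReal_mul (norm_nonneg c)]
  congr 2
  have := Real.pow_rpow_inv_natCast (norm_nonneg c) hd'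
  rw [one_div]
  exact_mod_cast this

lemma uscRegularization_smul (u : (Fin n → ℂ) → ℝ≥0∞) {c : ℂ} (hc : c ≠ 0) (z : Fin n → ℂ) :
    uscRegularization u (c • z) = uscRegularization (fun w => u (c • w)) z := by
  have h : map (fun w : Fin n → ℂ => c • w) (𝓝 z) = 𝓝 (c • z) :=
    (Homeomorph.smulOfNeZero (α := Fin n → ℂ) c hc).map_nhds_eq z
  rw [uscRegularization, uscRegularization, ← h, limsup, limsup, map_map]
  rfl

lemma uscRegularization_hBK_smul (hP : ∀ d j, (P d j).IsHomogeneous d) {c : ℂ} (hc : c ≠ 0)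
    (z : Fin n → ℂ) :
    uscRegularization (hBK P) (c • z) = ENNReal.ofReal ‖c‖ * uscRegularization (hBK P) z := by
  rw [uscRegularization_smul _ hc, funext (hBK_smul hP c), uscRegularization, uscRegularization,
    ENNReal.limsup_const_mul_of_ne_top ENNReal.ofReal_ne_top]

lemma upperSemicontinuous_uscRegularization (u : (Fin n → ℂ) → ℝ≥0∞) :
    UpperSemicontinuous (uscRegularization u) := by
  intro z a ha
  obtain ⟨b, hb, hba⟩ := exists_between ha
  have h1 : ∀ᶠ w in 𝓝 z, u w < b := eventually_lt_of_limsup_lt hb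
  filter_upwards [eventually_eventually_nhds.mpr h1] with w hw
  exact (limsup_le_of_le (h := hw.mono fun _ h => h.le)).trans_lt hba

/-- C^(1/(2d)) → 1 for every C > 0; replacing C by max C 1 keeps the base positive. -/
lemma hBK_le_one {z : Fin n → ℂ} {C : ℝ}
    (hC : ∀ d, ∑ j, ‖MvPolynomial.eval z (P d j)‖ ^ 2 ≤ C) : hBK P z ≤ 1 := by
  have h1 : Tendsto (fun d : ℕ => ENNReal.ofReal (max C 1 ^ (1 / (2 * (d : ℝ))))) atTop (𝓝 1) := by
    rw [← ENNReal.ofReal_one]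
    refine ENNReal.tendsto_ofReal ?_
    have h2 : Tendsto (fun d : ℕ => 1 / (2 * (d : ℝ))) atTop (𝓝 0) :=
      tendsto_const_nhds.div_atTop
        (tendsto_natCast_atTop_atTop.const_mul_atTop (by norm_num))
    have h3 : (max C 1) ≠ 0 := by positivity
    simpa using tendsto_const_nhds.rpow h2 (Or.inl h3)
  rw [← h1.limsup_eq]
  refine limsup_le_limsup (Eventually.of_forall fun d => ?_)
  refine ENNReal.ofReal_le_ofReal (Real.rpow_le_rpow (by positivity) ?_ (by positivity))
  exact (hC d).trans (le_max_left _ _)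

lemma uscRegularization_le_of_isOpen {u : (Fin n → ℂ) → ℝ≥0∞} {U : Set (Fin n → ℂ)}
    (hU : IsOpen U) {a : ℝ≥0∞} (h : ∀ w ∈ U, u w ≤ a) {z : Fin n → ℂ} (hz : z ∈ U) :
    uscRegularization u z ≤ a :=
  limsup_le_of_le (h := by filter_upwards [hU.mem_nhds hz] with w hw using h w hw)

/-- By homogeneity, `h_BK ≤ 1` on an open set improves to a strict inequality for `h_BK^*`. -/
lemma uscRegularization_hBK_lt_one (hP : ∀ d j, (P d j).IsHomogeneous d) {U : Set (Fin n → ℂ)}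
    (hU : IsOpen U) (h : ∀ w ∈ U, hBK P w ≤ 1) {z : Fin n → ℂ} (hz : z ∈ U) :
    uscRegularization (hBK P) z < 1 := by
  have hc : ContinuousAt (fun t : ℝ => (t : ℂ) • z) 1 := by fun_prop
  have h1 := hc.preimage_mem_nhds (by simpa using hU.mem_nhds hz)
  -- Take a real t > 1 with tz ∈ U: then t · h_BK^*(z) = h_BK^*(tz) ≤ 1.
  obtain ⟨t, ht, ht1⟩ := (nonempty_of_mem (inter_mem (mem_nhdsWithin_of_mem_nhds h1)
    (self_mem_nhdsWithin (a := (1 : ℝ)) (s := Set.Ioi 1))))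
  have ht1' : (1 : ℝ) < t := ht1
  have h2 := uscRegularization_le_of_isOpen hU h ht
  rw [uscRegularization_hBK_smul hP (by exact_mod_cast (by linarith : t ≠ 0))] at h2
  rw [Complex.norm_real, Real.norm_of_nonneg (by linarith)] at h2
  by_contra! h3
  have h4 : ENNReal.ofReal t ≤ 1 := by
    calc ENNReal.ofReal t = ENNReal.ofReal t * 1 := (mul_one _).symm
      _ ≤ _ := by gcongr
      _ ≤ 1 := h2
  rw [ENNReal.ofReal_le_one] at h4
  linarith

/-- Some nonzero multiple tz lies in U, whence |t| · h_BK^*(z) ≤ 1. -/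
lemma uscRegularization_hBK_ne_top (hP : ∀ d j, (P d j).IsHomogeneous d) {U : Set (Fin n → ℂ)}
    (hU : IsOpen U) (h0 : 0 ∈ U) (h : ∀ w ∈ U, hBK P w ≤ 1) (z : Fin n → ℂ) :
    uscRegularization (hBK P) z ≠ ∞ := by
  have hc : ContinuousAt (fun t : ℂ => t • z) 0 := by fun_prop
  have h1 := hc.preimage_mem_nhds (by simpa using hU.mem_nhds h0)
  obtain ⟨t, ht, ht1⟩ := (nonempty_of_mem (inter_mem (mem_nhdsWithin_of_mem_nhds h1)
    (self_mem_nhdsWithin (a := (0 : ℂ)) (s := {0}ᶜ))))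
  have ht0 : t ≠ 0 := ht1
  have h2 := uscRegularization_le_of_isOpen hU h ht
  rw [uscRegularization_hBK_smul hP ht0] at h2
  intro h3
  rw [h3, ENNReal.mul_top (by simpa using ht0)] at h2
  exact absurd h2 (by simp)

lemma isBalancedFunction_hBKStar (hP : ∀ d j, (P d j).IsHomogeneous d)
    (hfin : ∀ z, uscRegularization (hBK P) z ≠ ∞) : IsBalancedFunction (hBKStar P) := by
  have hne : ∀ (c : ℂ) (z : Fin n → ℂ), c ≠ 0 → hBKStar P (c • z) = ‖c‖ * hBKStar P z := by
    intro c z hc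
    rw [hBKStar, uscRegularization_hBK_smul hP hc, ENNReal.toReal_mul,
      ENNReal.toReal_ofReal (norm_nonneg _), hBKStar]
  refine ⟨fun z => ENNReal.toReal_nonneg, fun z a ha => ?_, fun c z => ?_⟩
  · have ha0 : 0 < a := ENNReal.toReal_nonneg.trans_lt ha
    have h1 : uscRegularization (hBK P) z < ENNReal.ofReal a :=
      (ENNReal.lt_ofReal_iff_toReal_lt (hfin z)).mpr ha
    filter_upwards [upperSemicontinuous_uscRegularization _ z _ h1] with w hw
    exact (ENNReal.lt_ofReal_iff_toReal_lt (hfin w)).mp hw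
  · rcases eq_or_ne c 0 with rfl | hc
    · have := hne 2 0 two_ne_zero
      rw [smul_zero, Complex.norm_ofNat] at this
      rw [zero_smul, norm_zero, zero_mul]
      linarith
    · exact hne c z hc

lemma mem_balancedDomain_hBKStar (hfin : ∀ z, uscRegularization (hBK P) z ≠ ∞) {z : Fin n → ℂ} :
    z ∈ balancedDomain (hBKStar P) ↔ uscRegularization (hBK P) z < 1 := by
  change (uscRegularization (hBK P) z).toReal < 1 ↔ _
  rw [← ENNReal.lt_ofReal_iff_toReal_lt (hfin z), ENNReal.ofReal_one]

/-- If `h_BK z < a`, then the homogeneous parts of the orthonormal basis decay like `a ^ d`. -/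
lemma eventually_sum_sq_le_of_hBK_lt {z : Fin n → ℂ} {a : ℝ} (ha : hBK P z < ENNReal.ofReal a) :
    ∀ᶠ d in atTop, ∑ j, ‖MvPolynomial.eval z (P d j)‖ ^ 2 ≤ (a ^ d) ^ 2 := by
  filter_upwards [eventually_lt_of_limsup_lt ha, eventually_ge_atTop 1] with d hd hd1
  have hd' : (2 * d : ℕ) ≠ 0 := by omega
  set S := ∑ j, ‖MvPolynomial.eval z (P d j)‖ ^ 2
  have hS : 0 ≤ S := by positivity
  have h1 : S ^ (1 / (2 * (d : ℝ))) < a := (ENNReal.ofReal_lt_ofReal_iff_of_nonneg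
    (by positivity)).mp hd
  have h2 : (S ^ (1 / (2 * (d : ℝ)))) ^ (2 * d) = S := by
    have := Real.rpow_inv_natCast_pow hS hd'
    rw [one_div]
    exact_mod_cast this
  calc S = (S ^ (1 / (2 * (d : ℝ)))) ^ (2 * d) := h2.symm
    _ ≤ a ^ (2 * d) := by gcongr
    _ = _ := by ring

end HBK

/-! ### Jensen's formula and Hartogs' lemma -/

section Hartogs

open MeromorphicOn in
-- Jensen's formula, in which the zeros in the disc contribute nonnegative terms. The positive part
-- of the logarithm is continuous, so its integrability is immediate; it also covers q 0 = 0, where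
-- `Real.log 0 = 0`.
lemma log_norm_le_circleAverage_posLog {q : ℂ → ℂ} (hq : Differentiable ℂ q) :
    Real.log ‖q 0‖ ≤ Real.circleAverage (fun c => Real.posLog ‖q c‖) 0 1 := by
  have hcont : Continuous fun c => Real.posLog ‖q c‖ := Real.continuous_posLog.comp hq.continuous.norm
  rcases eq_or_ne (q 0) 0 with h0 | h0
  · rw [h0, norm_zero, Real.log_zero]
    exact Real.circleAverage_nonneg_of_nonneg fun _ _ => Real.posLog_nonneg
  have ha : AnalyticOnNhd ℂ q (Metric.closedBall 0 |1|) := fun z _ => hq.analyticAt z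
  have hJ := ha.circleAverage_log_norm one_ne_zero h0
  have hnn : 0 ≤ ∑ᶠ u, (divisor q (Metric.closedBall 0 |1|) u : ℝ) *
      Real.log (1 * ‖(0 : ℂ) - u‖⁻¹) := by
    refine finsum_nonneg fun u => ?_
    by_cases hu : u ∈ Metric.closedBall (0 : ℂ) |1|
    · refine mul_nonneg (by exact_mod_cast ha.divisor_nonneg u) ?_
      rw [one_mul, zero_sub, norm_neg, Real.log_inv, neg_nonneg]
      exact Real.log_nonpos (norm_nonneg _) (by simpa using hu)
    · rw [Function.locallyFinsuppWithin.apply_eq_zero_of_notMem _ hu]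
      simp
  have hmono : Real.circleAverage (fun c => Real.log ‖q c‖) 0 1 ≤
      Real.circleAverage (fun c => Real.posLog ‖q c‖) 0 1 := by
    refine Real.circleAverage_mono ?_ hcont.continuousOn.circleIntegrable' fun c _ => le_max_right _ _
    exact (ha.mono Metric.sphere_subset_closedBall).meromorphicOn.circleIntegrable_log_norm
  linarith

variable {n : ℕ}

/-- The sub-mean value property of `log ‖Q‖` on polydiscs. -/
lemma log_norm_mul_volume_le {Q : (Fin n → ℂ) → ℂ} (hQ : Differentiable ℂ Q) (z : Fin n → ℂ)
    (r : ℝ) : volume.real (Metric.ball (0 : Fin n → ℂ) r) * Real.log ‖Q z‖ ≤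
      ∫ w in Metric.ball z r, Real.posLog ‖Q w‖ := by
  have hcont : Continuous fun w => Real.posLog ‖Q w‖ := Real.continuous_posLog.comp hQ.continuous.norm
  have hi : IntegrableOn (fun w => Real.posLog ‖Q w‖) (Metric.ball z r) :=
    (hcont.continuousOn.integrableOn_compact (isCompact_closedBall z r)).mono_set
      Metric.ball_subset_closedBall
  have hA := integrableOn_circleAverage_and_setIntegral measurableSet_ball
    (fun c hc u hu => by simpa [norm_smul, hc] using hu) (integrableOn_ball_translate hi)
  rw [← setIntegral_ball_eq_translate, ← hA.2, ← smul_eq_mul, ← setIntegral_const]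
  have hfin : IsFiniteMeasure (volume.restrict (Metric.ball (0 : Fin n → ℂ) r)) :=
    ⟨by simpa using measure_ball_lt_top⟩
  refine integral_mono (integrable_const _) hA.1 fun u => ?_
  have hq : Differentiable ℂ fun c : ℂ => Q (z + c • u) := hQ.comp (by fun_prop)
  simpa using log_norm_le_circleAverage_posLog hq

/-- Hartogs' lemma: pointwise exponential decay of locally exponentially bounded entire functions
is locally uniform. -/
lemma eventually_forall_norm_le_of_forall_eventually {Q : ℕ → (Fin n → ℂ) → ℂ}
    (hQ : ∀ d, Differentiable ℂ (Q d)) {z₀ : Fin n → ℂ} {r C a M : ℝ} (hr : 0 < r) (hC : 0 < C)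
    (ha : 0 < a) (ha1 : a < 1) (haM : a ≤ M)
    (hM : ∀ d, ∀ w ∈ Metric.ball z₀ (2 * r), ‖Q d w‖ ≤ C * M ^ d)
    (hev : ∀ w ∈ Metric.ball z₀ (2 * r), ∀ᶠ d in atTop, ‖Q d w‖ ≤ C * a ^ d) :
    ∀ᶠ d in atTop, ∀ z ∈ Metric.ball z₀ r, ‖Q d z‖ ≤ C * Real.sqrt a ^ d := by
  set V := volume.real (Metric.ball (0 : Fin n → ℂ) r)
  have hV : 0 < V := ENNReal.toReal_pos (Metric.measure_ball_pos _ _ hr).ne' measure_ball_lt_top.ne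
  set L := Real.log (M / a)
  have hL : 0 ≤ L := Real.log_nonneg ((one_le_div ha).mpr haM)
  -- B m is the set where the decay still fails for some d ≥ m. These sets decrease to the empty
  -- set, so their volumes tend to 0.
  let B : ℕ → Set (Fin n → ℂ) := fun m =>
    Metric.ball z₀ (2 * r) ∩ ⋃ d ≥ m, {w | C * a ^ d < ‖Q d w‖}
  have hBo : ∀ m, IsOpen (B m) := fun m => Metric.isOpen_ball.inter <| isOpen_iUnion fun d =>
    isOpen_iUnion fun _ => isOpen_lt continuous_const (hQ d).continuous.norm
  have hBanti : Antitone B := by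
    intro m k hmk w hw
    simp only [B, Set.mem_inter_iff, Set.mem_iUnion] at hw ⊢
    obtain ⟨h1, d, hd, h2⟩ := hw
    exact ⟨h1, d, le_trans hmk hd, h2⟩
  have hBfin : ∀ m, volume (B m) ≠ ∞ := fun m =>
    ((measure_mono Set.inter_subset_left).trans_lt measure_ball_lt_top).ne
  have hBempty : ⋂ m, B m = ∅ := by
    rw [Set.eq_empty_iff_forall_notMem]
    intro w hw
    rw [Set.mem_iInter] at hw
    obtain ⟨m, hm⟩ := eventually_atTop.mp (hev w (hw 0).1)
    have := (hw m).2
    simp only [Set.mem_iUnion] at this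
    obtain ⟨d, hd, h⟩ := this
    exact absurd (hm d hd) (not_le.mpr h)
  have hBlim : Tendsto (fun m => volume.real (B m)) atTop (𝓝 0) := by
    have := tendsto_measure_iInter_atTop (μ := volume)
      (fun m => (hBo m).measurableSet.nullMeasurableSet) hBanti ⟨0, hBfin 0⟩
    rw [hBempty, measure_empty] at this
    exact (ENNReal.tendsto_toReal ENNReal.zero_ne_top).comp this
  have hloga : 0 < -Real.log a := by linarith [Real.log_neg ha ha1]
  -- This m does not depend on the point z, which gives the uniformity. The factor 1 / 2 is what
  -- turns the rate a into √a.
  obtain ⟨m, hm⟩ : ∃ m, volume.real (B m) * L ≤ V * (-Real.log a / 2) := by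
    have h1 : Tendsto (fun m => volume.real (B m) * L) atTop (𝓝 0) := by
      simpa using hBlim.mul_const L
    exact (h1.eventually (ge_mem_nhds (by positivity))).exists
  filter_upwards [eventually_ge_atTop m] with d hd z hz
  have hsub : Metric.ball z r ⊆ Metric.ball z₀ (2 * r) :=
    Metric.ball_subset_ball' (by linarith [Metric.mem_ball.mp hz])
  have hε : 0 < C * a ^ d := by positivity
  have hεn : ∀ w, ‖((C * a ^ d : ℝ) : ℂ)⁻¹ * Q d w‖ = (C * a ^ d)⁻¹ * ‖Q d w‖ := fun w => by
    rw [norm_mul, norm_inv, Complex.norm_real, Real.norm_of_nonneg hε.le]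
  -- The sub-mean value inequality is applied to Q_d / (C aᵈ). The positive logarithm of its modulus
  -- is 0 off B m and at most d · log(M / a) on B m.
  have hkey := log_norm_mul_volume_le (Q := fun w => ((C * a ^ d : ℝ) : ℂ)⁻¹ * Q d w)
    ((hQ d).const_mul _) z r
  have hbound : ∀ w ∈ Metric.ball z r, Real.posLog ‖((C * a ^ d : ℝ) : ℂ)⁻¹ * Q d w‖ ≤
      (B m).indicator (fun _ => d * L) w := by
    intro w hw
    rw [hεn]
    by_cases hwB : w ∈ B m
    · rw [Set.indicator_of_mem hwB, Real.posLog]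
      refine max_le (by positivity) ?_
      rcases eq_or_lt_of_le (norm_nonneg (Q d w)) with h0 | h0
      · rw [← h0, mul_zero, Real.log_zero]; positivity
      rw [← Real.log_pow]
      refine Real.log_le_log (by positivity) ?_
      calc (C * a ^ d)⁻¹ * ‖Q d w‖ ≤ (C * a ^ d)⁻¹ * (C * M ^ d) := by
            gcongr; exact hM d w (hsub hw)
        _ = (M / a) ^ d := by rw [div_pow]; field_simp
    · rw [Set.indicator_of_notMem hwB]
      have h1 : ‖Q d w‖ ≤ C * a ^ d := by
        by_contra! h
        exact hwB ⟨hsub hw, by simp only [Set.mem_iUnion]; exact ⟨d, hd, h⟩⟩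
      refine (Real.posLog_eq_zero_iff _).mpr ?_ |>.le
      rw [abs_of_nonneg (by positivity), inv_mul_le_iff₀ hε, mul_one]
      exact h1
  have hint : ∫ w in Metric.ball z r, Real.posLog ‖((C * a ^ d : ℝ) : ℂ)⁻¹ * Q d w‖ ≤
      volume.real (B m) * (d * L) := by
    have hcont : Continuous fun w => Real.posLog ‖((C * a ^ d : ℝ) : ℂ)⁻¹ * Q d w‖ :=
      Real.continuous_posLog.comp (continuous_const.mul (hQ d).continuous).norm
    have hfin : IsFiniteMeasure (volume.restrict (Metric.ball z r)) :=
      ⟨by simpa using measure_ball_lt_top⟩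
    calc _ ≤ ∫ w in Metric.ball z r, (B m).indicator (fun _ => d * L) w := by
          refine setIntegral_mono_on ((hcont.continuousOn.integrableOn_compact
            (isCompact_closedBall z r)).mono_set Metric.ball_subset_closedBall)
            ((integrable_const (d * L)).indicator (hBo m).measurableSet) measurableSet_ball hbound
      _ = volume.real (Metric.ball z r ∩ B m) * (d * L) := by
          rw [setIntegral_indicator (hBo m).measurableSet, setIntegral_const, smul_eq_mul]
      _ ≤ _ := by
          gcongr
          · exact hBfin m
          · exact Set.inter_subset_right
  rcases eq_or_lt_of_le (norm_nonneg (Q d z)) with h0 | h0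
  · rw [← h0]; positivity
  rw [hεn] at hkey
  have h1 : V * Real.log ((C * a ^ d)⁻¹ * ‖Q d z‖) ≤ V * (d * (-Real.log a / 2)) := by
    calc _ ≤ volume.real (B m) * (d * L) := hkey.trans hint
      _ = d * (volume.real (B m) * L) := by ring
      _ ≤ d * (V * (-Real.log a / 2)) := by gcongr
      _ = _ := by ring
  have h2 := le_of_mul_le_mul_left h1 hV
  rw [Real.log_mul (by positivity) h0.ne', Real.log_inv, Real.log_mul hC.ne' (by positivity),
    Real.log_pow] at h2
  rw [← Real.log_le_log_iff h0 (by positivity), Real.log_mul hC.ne' (by positivity), Real.log_pow,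
    Real.log_sqrt ha.le]
  linarith

end Hartogs

/-! ### Bessel bounds in each degree -/

section HilbertBasisBounds

lemma norm_sum_mul_le {m : ℕ} {c p : Fin m → ℂ} {A B : ℝ} (hA : 0 ≤ A) (hB : 0 ≤ B)
    (hc : ∑ j, ‖c j‖ ^ 2 ≤ A ^ 2) (hp : ∑ j, ‖p j‖ ^ 2 ≤ B ^ 2) : ‖∑ j, c j * p j‖ ≤ A * B := by
  have h1 : ‖∑ j, c j * p j‖ ≤ ∑ j, ‖c j‖ * ‖p j‖ :=
    (norm_sum_le _ _).trans (le_of_eq (by simp_rw [norm_mul]))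
  refine h1.trans (abs_le_of_sq_le_sq' ?_ (by positivity)).2
  calc _ ≤ (∑ j, ‖c j‖ ^ 2) * ∑ j, ‖p j‖ ^ 2 := Finset.sum_mul_sq_le_sq_mul_sq _ _ _
    _ ≤ A ^ 2 * B ^ 2 := by gcongr
    _ = _ := by ring

variable {E : Type*} [NormedAddCommGroup E] [InnerProductSpace ℂ E] {N : ℕ → ℕ}
  (b : HilbertBasis (Σ d, Fin (N d)) ℂ E)

lemma HilbertBasis.sum_norm_repr_sq_le (g : E) (d : ℕ) :
    ∑ j, ‖b.repr g ⟨d, j⟩‖ ^ 2 ≤ ‖g‖ ^ 2 := by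
  simp_rw [b.repr_apply_apply]
  exact (b.orthonormal.comp (fun j : Fin (N d) => (⟨d, j⟩ : Σ d, Fin (N d)))
    (sigma_mk_injective (β := fun d => Fin (N d)))).sum_inner_products_le g (s := Finset.univ)

/-- Bessel's inequality for the Riesz representative of L. With L a point evaluation it bounds the
sums in h_BK by a constant independent of d. -/
lemma HilbertBasis.sum_norm_apply_sq_le [CompleteSpace E] (L : E →L[ℂ] ℂ) (d : ℕ) :
    ∑ j, ‖L (b ⟨d, j⟩)‖ ^ 2 ≤ ‖L‖ ^ 2 := by
  set x := (InnerProductSpace.toDual ℂ E).symm L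
  have hL : ∀ g, ‖L g‖ = ‖inner ℂ g x‖ := fun g => by
    rw [norm_inner_symm, InnerProductSpace.toDual_symm_apply]
  have hx : ‖L‖ = ‖x‖ := by simp [x]
  simp_rw [hL]
  rw [hx]
  exact (b.orthonormal.comp (fun j : Fin (N d) => (⟨d, j⟩ : Σ d, Fin (N d)))
    (sigma_mk_injective (β := fun d => Fin (N d)))).sum_inner_products_le x (s := Finset.univ)

end HilbertBasisBounds

/-! ### Extension to the set where h_BK^* < 1 -/

section Extension

variable {n : ℕ}

/-- Point evaluations are bounded functionals on the Bergman space, uniformly on sets with positive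
distance to the boundary. -/
lemma exists_clm_eq_apply {r : ℝ} (hr : 0 < r) : ∃ C : ℝ, 0 ≤ C ∧
    ∀ (D : Set (Fin n → ℂ)) (z : Fin n → ℂ), Metric.ball z r ⊆ D →
      ∃ L : bergmanSpace D →L[ℂ] ℂ, ‖L‖ ≤ C ∧ ∀ (g : bergmanSpace D) (f : (Fin n → ℂ) → ℂ),
        IsL2h D f → g =ᵐ[volume.restrict D] f → L g = f z := by
  obtain ⟨C, hC⟩ := exists_inner_eq_apply (n := n) hr
  refine ⟨max C 0, le_max_right _ _, fun D z hz => ?_⟩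
  obtain ⟨k, hk, hkf⟩ := hC D z hz
  refine ⟨(innerSL ℂ k).comp (bergmanSpace D).subtypeL, ?_, fun g f hf hgf => hkf g f hf hgf⟩
  refine ContinuousLinearMap.opNorm_le_bound _ (le_max_right _ _) fun g => ?_
  refine (norm_inner_le_norm k (g : Lp ℂ 2 (volume.restrict D))).trans ?_
  exact mul_le_mul_of_nonneg_right (hk.trans (le_max_left _ _)) (norm_nonneg _)

variable {D : Set (Fin n → ℂ)} {N : ℕ → ℕ} {P : ∀ d, Fin (N d) → MvPolynomial (Fin n) ℂ}
  {b : HilbertBasis (Σ d, Fin (N d)) ℂ (bergmanSpace D)}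

lemma isL2h_of_basis_eq (hb : ∀ d j, (b ⟨d, j⟩ : Lp ℂ 2 (volume.restrict D))
      =ᵐ[volume.restrict D] fun z => MvPolynomial.eval z (P d j)) (d : ℕ) (j : Fin (N d)) :
    IsL2h D fun z => MvPolynomial.eval z (P d j) :=
  isL2h_eval ((Lp.memLp _).ae_eq (hb d j))

/-- The Bergman kernel on the diagonal is bounded away from the boundary. -/
lemma exists_sum_sq_eval_le (hD : IsOpen D)
    (hb : ∀ d j, (b ⟨d, j⟩ : Lp ℂ 2 (volume.restrict D))
      =ᵐ[volume.restrict D] fun z => MvPolynomial.eval z (P d j)) {z₀ : Fin n → ℂ} (hz₀ : z₀ ∈ D) :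
    ∃ r > 0, ∃ C ≥ 0, ∀ z ∈ Metric.ball z₀ r, ∀ d,
      ∑ j, ‖MvPolynomial.eval z (P d j)‖ ^ 2 ≤ C ^ 2 := by
  have : CompleteSpace (bergmanSpace D) := completeSpace_bergmanSpace hD
  obtain ⟨r, hr, hrD⟩ := Metric.isOpen_iff.mp hD z₀ hz₀
  obtain ⟨C, hC0, hC⟩ := exists_clm_eq_apply (n := n) (half_pos hr)
  refine ⟨r / 2, half_pos hr, C, hC0, fun z hz d => ?_⟩
  obtain ⟨L, hL, hLe⟩ := hC D z
    ((Metric.ball_subset_ball' (by linarith [Metric.mem_ball.mp hz])).trans hrD)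
  simp_rw [← fun j => hLe _ _ (isL2h_of_basis_eq hb d j) (hb d j)]
  exact (b.sum_norm_apply_sq_le L d).trans (pow_le_pow_left₀ (norm_nonneg L) hL 2)

/-- Pointwise convergence of the expansion with respect to the homogeneous orthonormal basis. -/
lemma hasSum_homogeneous_expansion (hD : IsOpen D)
    (hb : ∀ d j, (b ⟨d, j⟩ : Lp ℂ 2 (volume.restrict D))
      =ᵐ[volume.restrict D] fun z => MvPolynomial.eval z (P d j))
    {g : bergmanSpace D} {f : (Fin n → ℂ) → ℂ} (hf : IsL2h D f) (hgf : g =ᵐ[volume.restrict D] f)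
    {z : Fin n → ℂ} (hz : z ∈ D) :
    HasSum (fun d => ∑ j, b.repr g ⟨d, j⟩ * MvPolynomial.eval z (P d j)) (f z) := by
  obtain ⟨r, hr, hrD⟩ := Metric.isOpen_iff.mp hD z hz
  obtain ⟨C, -, hC⟩ := exists_clm_eq_apply (n := n) hr
  obtain ⟨L, -, hLe⟩ := hC D z hrD
  have h1 := (b.hasSum_repr g).mapL L
  rw [hLe g f hf hgf] at h1
  refine h1.sigma fun d => ?_
  have h2 : ∀ j : Fin (N d), L (b.repr g ⟨d, j⟩ • b ⟨d, j⟩) =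
      b.repr g ⟨d, j⟩ * MvPolynomial.eval z (P d j) := fun j => by
    rw [map_smul, hLe _ _ (isL2h_of_basis_eq hb d j) (hb d j), smul_eq_mul]
  simp_rw [h2]
  exact hasSum_fintype _

/-- Dividing by M moves the ball of radius R into a fixed ball about 0 where the sums are bounded;
homogeneity restores Mᵈ. This is the a priori exponential bound for Hartogs' lemma, and C, M ≥ 1
lets the constants be matched with those of the decay. -/
lemma exists_sum_sq_eval_le_mul_pow (hD : IsOpen D) (h0 : 0 ∈ D)
    (hP : ∀ d j, (P d j).IsHomogeneous d)
    (hb : ∀ d j, (b ⟨d, j⟩ : Lp ℂ 2 (volume.restrict D))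
      =ᵐ[volume.restrict D] fun z => MvPolynomial.eval z (P d j)) (R : ℝ) :
    ∃ C ≥ 1, ∃ M ≥ 1, ∀ z ∈ Metric.ball (0 : Fin n → ℂ) R, ∀ d,
      ∑ j, ‖MvPolynomial.eval z (P d j)‖ ^ 2 ≤ (C * M ^ d) ^ 2 := by
  obtain ⟨r, hr, C, hC0, hC⟩ := exists_sum_sq_eval_le hD hb h0
  refine ⟨max C 1, le_max_right _ _, max (R / r) 1, le_max_right _ _, fun z hz d => ?_⟩
  set M := max (R / r) 1
  have hM : 0 < M := lt_max_of_lt_right one_pos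
  have hz' : ((M : ℂ)⁻¹ • z) ∈ Metric.ball (0 : Fin n → ℂ) r := by
    rw [mem_ball_zero_iff] at hz ⊢
    rw [norm_smul, norm_inv, Complex.norm_real, Real.norm_of_nonneg hM.le, inv_mul_lt_iff₀ hM]
    have : R / r * r ≤ M * r := by gcongr; exact le_max_left _ _
    rw [div_mul_cancel₀ _ hr.ne'] at this
    linarith
  have h1 : ∀ j, ‖MvPolynomial.eval z (P d j)‖ ^ 2 =
      (M ^ d) ^ 2 * ‖MvPolynomial.eval ((M : ℂ)⁻¹ • z) (P d j)‖ ^ 2 := fun j => by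
    have hM' : (M : ℂ) ≠ 0 := by exact_mod_cast hM.ne'
    conv_lhs => rw [← smul_inv_smul₀ hM' z, (hP d j).eval_smul, norm_mul, norm_pow,
      Complex.norm_real, Real.norm_of_nonneg hM.le]
    ring
  simp_rw [h1]
  rw [← Finset.mul_sum, mul_pow, mul_comm]
  gcongr
  exact (hC _ hz' d).trans (pow_le_pow_left₀ hC0 (le_max_left _ _) 2)

/-- Every function in `L²_h(D)` extends holomorphically to the set where `h_BK^* < 1`. -/
lemma exists_differentiableOn_extension (hD : IsOpen D) (h0 : 0 ∈ D)
    (hP : ∀ d j, (P d j).IsHomogeneous d)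
    (hb : ∀ d j, (b ⟨d, j⟩ : Lp ℂ 2 (volume.restrict D))
      =ᵐ[volume.restrict D] fun z => MvPolynomial.eval z (P d j))
    {f : (Fin n → ℂ) → ℂ} (hf : IsL2h D f) :
    ∃ F : (Fin n → ℂ) → ℂ, DifferentiableOn ℂ F {z | uscRegularization (hBK P) z < 1} ∧
      ∀ z ∈ D, F z = f z := by
  let g : bergmanSpace D := ⟨hf.memLp.toLp f, f, hf, hf.memLp.coeFn_toLp⟩
  have hgf : g =ᵐ[volume.restrict D] f := hf.memLp.coeFn_toLp
  let Q : ℕ → (Fin n → ℂ) → ℂ := fun d z => ∑ j, b.repr g ⟨d, j⟩ * MvPolynomial.eval z (P d j)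
  have hQ : ∀ d, Differentiable ℂ (Q d) := fun d =>
    Differentiable.fun_sum fun j _ => (differentiable_eval (P d j)).const_mul _
  have hQle : ∀ d z B, 0 ≤ B → ∑ j, ‖MvPolynomial.eval z (P d j)‖ ^ 2 ≤ B ^ 2 →
      ‖Q d z‖ ≤ ‖g‖ * B := fun d z B hB h =>
    norm_sum_mul_le (norm_nonneg g) hB (b.sum_norm_repr_sq_le g d) h
  refine ⟨fun z => ∑' d, Q d z, fun z₀ hz₀ => ?_, fun z hz =>
    (hasSum_homogeneous_expansion hD hb hf hgf hz).tsum_eq⟩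
  refine DifferentiableAt.differentiableWithinAt ?_
  -- Because the regularization at z₀ is a limsup over a full neighbourhood, h_BK < a holds on a
  -- whole ball around z₀. This is where h_BK^* rather than h_BK is needed.
  obtain ⟨a', ha1', ha2'⟩ := exists_between (show uscRegularization (hBK P) z₀ < 1 from hz₀)
  set a := a'.toReal
  have haa : ENNReal.ofReal a = a' := ENNReal.ofReal_toReal (ha2'.trans ENNReal.one_lt_top).ne
  have ha : 0 < a := ENNReal.toReal_pos (bot_le.trans_lt ha1').ne' (ha2'.trans ENNReal.one_lt_top).ne
  have ha1 : a < 1 := by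
    have := ENNReal.toReal_strict_mono ENNReal.one_ne_top ha2'
    simpa using this
  obtain ⟨r', hr', hball⟩ := Metric.eventually_nhds_iff_ball.mp (eventually_lt_of_limsup_lt ha1')
  set r := r' / 2
  have hr : 0 < r := half_pos hr'
  have hrr : 2 * r = r' := by simp only [r]; ring
  obtain ⟨C, hC1, M, hM1, hCM⟩ := exists_sum_sq_eval_le_mul_pow hD h0 hP hb (‖z₀‖ + 2 * r)
  have hCM' : ∀ d, ∀ w ∈ Metric.ball z₀ (2 * r), ‖Q d w‖ ≤ (‖g‖ + 1) * C * M ^ d := by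
    intro d w hw
    have hw' : w ∈ Metric.ball (0 : Fin n → ℂ) (‖z₀‖ + 2 * r) := by
      rw [mem_ball_iff_norm] at hw
      rw [mem_ball_zero_iff]
      have := norm_add_le z₀ (w - z₀)
      rw [add_sub_cancel] at this
      linarith
    refine (hQle d w (C * M ^ d) (by positivity) (hCM w hw' d)).trans ?_
    rw [mul_assoc]
    gcongr
    linarith
  have hev : ∀ w ∈ Metric.ball z₀ (2 * r), ∀ᶠ d in atTop, ‖Q d w‖ ≤ (‖g‖ + 1) * C * a ^ d := by
    intro w hw
    have hw' := hball w (hrr ▸ hw)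
    rw [← haa] at hw'
    filter_upwards [eventually_sum_sq_le_of_hBK_lt hw'] with d hd
    refine (hQle d w _ (by positivity) hd).trans ?_
    gcongr
    nlinarith [norm_nonneg g]
  have hH := eventually_forall_norm_le_of_forall_eventually hQ hr (C := (‖g‖ + 1) * C)
    (by positivity) ha ha1 (by linarith) hCM' hev
  obtain ⟨m, hm⟩ := eventually_atTop.mp hH
  -- A summable majorant: the crude bound for the finitely many d < m, the Hartogs bound from m on.
  let u : ℕ → ℝ := fun d => if d < m then (‖g‖ + 1) * C * M ^ d else (‖g‖ + 1) * C * Real.sqrt a ^ d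
  have hu0 : ∀ d, 0 ≤ u d := fun d => by
    simp only [u]; split_ifs <;> positivity
  have hu : Summable u := by
    rw [← summable_nat_add_iff m]
    have h1 : (fun d => u (d + m)) = fun d => (‖g‖ + 1) * C * Real.sqrt a ^ (d + m) := by
      funext d; simp [u]
    rw [h1]
    have h2 : Real.sqrt a < 1 := by rw [Real.sqrt_lt' one_pos]; simpa using ha1
    exact ((summable_nat_add_iff m).mpr
      (summable_geometric_of_lt_one (Real.sqrt_nonneg a) h2)).mul_left _
  have hQu : ∀ z ∈ Metric.ball z₀ r, ∀ d, ‖Q d z‖ ≤ u d := by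
    intro z hz d
    simp only [u]
    split_ifs with hd
    · exact hCM' d z (Metric.ball_subset_ball (by linarith) hz)
    · exact hm d (not_lt.mp hd) z hz
  refine differentiableAt_of_tendsto (f := fun k z => ∑ d ∈ Finset.range k, Q d z) hr
    (M := ∑' d, u d) (Eventually.of_forall fun k => ⟨?_, fun z hz => ?_⟩) fun z hz => ?_
  · exact (Differentiable.fun_sum fun d _ => hQ d).differentiableOn
  · calc ‖∑ d ∈ Finset.range k, Q d z‖ ≤ ∑ d ∈ Finset.range k, u d :=
          norm_sum_le_of_le _ fun d _ => hQu z hz d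
      _ ≤ _ := hu.sum_le_tsum _ fun d _ => hu0 d
  · exact (Summable.of_norm_bounded hu (hQu z hz)).hasSum.tendsto_sum_nat

end Extension

/-! ### Propagation of continuous linear dependence -/

section PointwiseLimits

variable {V : Type*} [NormedAddCommGroup V] [NormedSpace ℂ V] [CompleteSpace V]

/-- By Banach–Steinhaus a pointwise limit of continuous functionals is continuous. -/
lemma exists_clm_of_tendsto {φ : ℕ → V → ℂ} {ψ : V → ℂ}
    (hφ : ∀ᶠ m in atTop, ∃ L : V →L[ℂ] ℂ, ∀ g, L g = φ m g)
    (h : ∀ g, Tendsto (fun m => φ m g) atTop (𝓝 (ψ g))) : ∃ L : V →L[ℂ] ℂ, ∀ g, L g = ψ g := by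
  obtain ⟨m₀, hm₀⟩ := eventually_atTop.mp hφ
  choose L hL using hm₀
  have ht : Tendsto (fun (m : ℕ) (g : V) => L (m + m₀) (Nat.le_add_left _ _) g) atTop (𝓝 ψ) := by
    rw [tendsto_pi_nhds]
    intro g
    simp_rw [hL]
    exact (h g).comp (tendsto_add_atTop_nat m₀)
  exact ⟨continuousLinearMapOfTendsto _ ht, fun g => rfl⟩

/-- If the values of a family of holomorphic functions on a disc depend linearly and continuously on
the parameter near the centre of the disc, then they do so on the whole disc. -/
lemma exists_clm_eq_of_eventually {G : V → ℂ → ℂ} {R : ℝ}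
    (hG : ∀ g, DifferentiableOn ℂ (G g) (Metric.ball 0 R))
    (h : ∀ᶠ t in 𝓝 0, ∃ L : V →L[ℂ] ℂ, ∀ g, L g = G g t) {t : ℂ} (ht : t ∈ Metric.ball 0 R) :
    ∃ L : V →L[ℂ] ℂ, ∀ g, L g = G g t := by
  have hR : 0 < R := Metric.nonempty_ball.mp ⟨_, ht⟩
  obtain ⟨U, hU, hUo, h0U⟩ := mem_nhds_iff.mp (inter_mem h (Metric.ball_mem_nhds 0 hR))
  -- Derivatives at points of U are limits of difference quotients, so they inherit the dependence
  -- on g. The partial sums of the Taylor series at 0 then carry it to the whole disc.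
  have hder : ∀ k : ℕ, ∀ t ∈ U, ∃ L : V →L[ℂ] ℂ, ∀ g, L g = iteratedDeriv k (G g) t := by
    intro k
    induction k with
    | zero => simpa using fun t ht => (hU ht).1
    | succ k ih =>
      intro t ht
      have hk : Tendsto (fun m : ℕ => ((m : ℂ) + 1)⁻¹) atTop (𝓝 0) := by
        simpa using tendsto_one_div_add_atTop_nhds_zero_nat (𝕜 := ℂ)
      have hk0 : ∀ m : ℕ, ((m : ℂ) + 1) ≠ 0 := fun m => by exact_mod_cast m.succ_ne_zero
      have hmem : ∀ᶠ m : ℕ in atTop, t + ((m : ℂ) + 1)⁻¹ ∈ U := by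
        have : Tendsto (fun m : ℕ => t + ((m : ℂ) + 1)⁻¹) atTop (𝓝 t) := by
          simpa using hk.const_add t
        exact this (hUo.mem_nhds ht)
      refine exists_clm_of_tendsto (φ := fun m g => ((m : ℂ) + 1) *
        (iteratedDeriv k (G g) (t + ((m : ℂ) + 1)⁻¹) - iteratedDeriv k (G g) t)) ?_ fun g => ?_
      · filter_upwards [hmem] with m hm
        obtain ⟨L₁, h₁⟩ := ih _ hm
        obtain ⟨L₂, h₂⟩ := ih _ ht
        exact ⟨((m : ℂ) + 1) • (L₁ - L₂), fun g => by simp [h₁, h₂]⟩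
      · have han : AnalyticAt ℂ (G g) t :=
          (hG g).analyticAt (Metric.isOpen_ball.mem_nhds (hU ht).2)
        have hd : DifferentiableAt ℂ (iteratedDeriv k (G g)) t := by
          rw [iteratedDeriv_eq_iterate]
          exact (han.iterated_deriv k).differentiableAt
        rw [iteratedDeriv_succ]
        have h2 : Tendsto (fun m : ℕ => ((m : ℂ) + 1)⁻¹) atTop (𝓝[≠] 0) :=
          tendsto_nhdsWithin_iff.mpr ⟨hk, Eventually.of_forall fun m => inv_ne_zero (hk0 m)⟩
        refine (hd.hasDerivAt.tendsto_slope_zero.comp h2).congr fun m => ?_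
        simp
  choose L hL using fun k => hder k 0 h0U
  refine exists_clm_of_tendsto (φ := fun m g => ∑ k ∈ Finset.range m,
    (k.factorial : ℂ)⁻¹ • (t - 0) ^ k • iteratedDeriv k (G g) 0)
    (Eventually.of_forall fun m => ⟨∑ k ∈ Finset.range m,
      (k.factorial : ℂ)⁻¹ • (t - 0) ^ k • L k, fun g => ?_⟩) fun g => ?_
  · simp [hL]
  · exact (Complex.hasSum_taylorSeries_on_ball (hG g) ht).tendsto_sum_nat

end PointwiseLimits

/-! ### Holomorphic families on Riemann domains -/

namespace RiemannDomain

variable {n : ℕ}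

/-- All charts are restrictions of the projection, so transition maps are identities and any chart
tests holomorphy. -/
lemma IsHolomorphic.differentiableOn {X : RiemannDomain.{v} n} {F : X.carrier → ℂ}
    (hF : X.IsHolomorphic F) {e : OpenPartialHomeomorph X.carrier (Fin n → ℂ)} (he : X.proj = e) :
    DifferentiableOn ℂ (F ∘ e.symm) e.target := by
  intro w hw
  obtain ⟨e', hx, hEq, hd⟩ := hF (e.symm w)
  refine DifferentiableAt.differentiableWithinAt ?_
  have hwe : e' (e.symm w) = w := by rw [← hEq hx, he, e.right_inv hw]
  have hw' : w ∈ e'.target := hwe ▸ e'.map_source hx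
  refine (hd.differentiableAt (e'.open_target.mem_nhds hw')).congr_of_eventuallyEq ?_
  have h1 : ∀ᶠ u in 𝓝 w, e.symm u ∈ e'.source :=
    (e.continuousAt_symm hw).eventually (e'.open_source.mem_nhds hx)
  filter_upwards [h1, e.open_target.mem_nhds hw] with u hu hut
  have h2 : e' (e.symm u) = u := by rw [← hEq hu, he, e.right_inv hut]
  change F (e.symm u) = F (e'.symm u)
  rw [← e'.left_inv hu, h2]

lemma isHolomorphic_comp_proj (X : RiemannDomain.{v} n) {f : (Fin n → ℂ) → ℂ}
    (hf : Differentiable ℂ f) : X.IsHolomorphic (f ∘ X.proj) := by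
  intro x
  obtain ⟨e, hx, he⟩ := X.isLocalHomeomorph_proj x
  refine ⟨e, hx, fun y _ => by rw [he], hf.differentiableOn.congr fun w hw => ?_⟩
  simp [he, e.right_inv hw]

/-- A subset with nonempty interior of a Riemann domain is everything if membership propagates along
discs. -/
lemma eq_univ_of_disc_propagation (X : RiemannDomain.{v} n) {T : Set X.carrier}
    (hT : (interior T).Nonempty)
    (hprop : ∀ e : OpenPartialHomeomorph X.carrier (Fin n → ℂ), X.proj = e →
      ∀ (y v : Fin n → ℂ) (R : ℝ), 1 < R → (∀ t ∈ Metric.ball (0 : ℂ) R, y + t • v ∈ e.target) →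
      (∀ᶠ t in 𝓝 (0 : ℂ), e.symm (y + t • v) ∈ T) → e.symm (y + v) ∈ T) : T = Set.univ := by
  have hcl : IsClosed (interior T) := by
    refine isClosed_of_closure_subset fun x hx => ?_
    obtain ⟨e, hxe, he⟩ := X.isLocalHomeomorph_proj x
    obtain ⟨r, hr, hrt⟩ := Metric.isOpen_iff.mp e.open_target (e x) (e.map_source hxe)
    have hO : IsOpen (e.source ∩ e ⁻¹' Metric.ball (e x) (r / 3)) :=
      e.isOpen_inter_preimage Metric.isOpen_ball
    obtain ⟨y, ⟨hye, hyr⟩, hyT⟩ := mem_closure_iff.mp hx _ hO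
      ⟨hxe, Metric.mem_ball_self (by positivity)⟩
    have hyr' : dist (e y) (e x) < r / 3 := hyr
    refine mem_interior.mpr ⟨e.source ∩ e ⁻¹' Metric.ball (e y) (r / 2), ?_,
      e.isOpen_inter_preimage Metric.isOpen_ball, hxe, ?_⟩
    · rintro u ⟨hu, hur⟩
      have hur' : ‖e u - e y‖ < r / 2 := by rw [← dist_eq_norm]; exact hur
      -- The radii fit because r/3 + (4/3)(r/2) = r keeps the disc in the chart, while r/3 < r/2
      -- puts x in the new neighbourhood.
      have key := hprop e he (e y) (e u - e y) (4 / 3) (by norm_num) ?_ ?_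
      · rwa [add_sub_cancel, e.left_inv hu] at key
      · intro t ht
        refine hrt ?_
        rw [Metric.mem_ball, dist_eq_norm]
        have h1 : ‖e y - e x‖ < r / 3 := by rw [← dist_eq_norm]; exact hyr'
        have h2 : ‖t • (e u - e y)‖ ≤ 4 / 3 * (r / 2) := by
          rw [norm_smul]
          rw [mem_ball_zero_iff] at ht
          gcongr
        have h3 := norm_add_le (e y - e x) (t • (e u - e y))
        rw [show e y + t • (e u - e y) - e x = e y - e x + t • (e u - e y) by abel]
        linarith
      · have hc : ContinuousAt (fun t : ℂ => e.symm (e y + t • (e u - e y))) 0 := by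
          refine ContinuousAt.comp (g := e.symm) ?_ (by fun_prop)
          simpa using e.continuousAt_symm (e.map_source hye)
        refine (hc.eventually (isOpen_interior.mem_nhds (s := interior T) ?_)).mono
          fun t ht => interior_subset ht
        simpa [e.left_inv hye] using hyT
    · change dist (e x) (e y) < r / 2
      rw [dist_comm]; linarith
  have := IsClopen.eq_univ ⟨hcl, isOpen_interior⟩ hT
  exact Set.eq_univ_of_univ_subset (this ▸ interior_subset)

/-- A family of holomorphic functions on a Riemann domain, parametrized by a Banach space, whose
values are continuous linear in the parameter on a nonempty open set, is locally uniformly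
bounded by the norm of the parameter. -/
lemma exists_clm_norm_le {V : Type*} [NormedAddCommGroup V] [NormedSpace ℂ V] [CompleteSpace V]
    (X : RiemannDomain.{v} n) {F : V → X.carrier → ℂ} (hF : ∀ g, X.IsHolomorphic (F g))
    {T : Set X.carrier} (hT : (interior T).Nonempty)
    (hFT : ∀ x ∈ T, ∃ L : V →L[ℂ] ℂ, ∀ g, L g = F g x) (x : X.carrier) :
    ∃ r > 0, ∃ C : ℝ, ∀ w ∈ Metric.ball (X.proj x) r, ∃ y, X.proj y = w ∧
      ∃ L : V →L[ℂ] ℂ, ‖L‖ ≤ C ∧ ∀ g, L g = F g y := by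
  -- Neither linearity of g ↦ F g nor uniqueness of the extensions is presupposed: the set of points
  -- with continuous linear dependence on g is shown to be everything by propagation along discs.
  have hall : {x | ∃ L : V →L[ℂ] ℂ, ∀ g, L g = F g x} = Set.univ := by
    refine X.eq_univ_of_disc_propagation (hT.mono (interior_mono hFT)) fun e he y v R hR hmem hev => ?_
    have := exists_clm_eq_of_eventually (G := fun g t => F g (e.symm (y + t • v))) (R := R) (t := 1)
      (fun g => differentiableOn_slice ((hF g).differentiableOn he) y v hmem) hev (by simpa using hR)
    simpa using this
  choose L hL using fun x => (Set.eq_univ_iff_forall.mp hall x)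
  obtain ⟨e, hxe, he⟩ := X.isLocalHomeomorph_proj x
  obtain ⟨r, hr, hrt⟩ := Metric.isOpen_iff.mp e.open_target (e x) (e.map_source hxe)
  have hsub : Metric.closedBall (e x) (r / 2) ⊆ e.target :=
    (Metric.closedBall_subset_ball (by linarith)).trans hrt
  -- For fixed g the values are bounded on the compact ball by continuity; uniform boundedness then
  -- bounds the norms of the functionals.
  obtain ⟨C, hC⟩ := banach_steinhaus
    (g := fun w : Metric.closedBall (e x) (r / 2) => L (e.symm w)) fun g => by
      obtain ⟨C, hC⟩ := (isCompact_closedBall (e x) (r / 2)).exists_bound_of_continuousOn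
        (((hF g).differentiableOn he).continuousOn.mono hsub)
      exact ⟨C, fun w => by rw [hL]; exact hC w w.2⟩
  refine ⟨r / 2, half_pos hr, C, fun w hw => ?_⟩
  rw [he] at hw ⊢
  have hw' := Metric.ball_subset_closedBall hw
  exact ⟨e.symm w, e.right_inv (hsub hw'), L (e.symm w), hC ⟨w, hw'⟩, hL _⟩

end RiemannDomain

/-! ### Maximality of the envelope -/

section Envelope

variable {n : ℕ}

/-- In a chart, β is a local inverse of the projection, so its image contains an open set. -/
lemma IsL2hExtension.nonempty_interior_range {D : Set (Fin n → ℂ)} (hD : IsOpen D)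
    (hne : D.Nonempty) {Z : RiemannDomain.{v} n} {β : D → Z.carrier} (hβ : IsL2hExtension D Z β) :
    (interior (Set.range β)).Nonempty := by
  obtain ⟨z₀, hz₀⟩ := hne
  obtain ⟨e, hxe, he⟩ := Z.isLocalHomeomorph_proj (β ⟨z₀, hz₀⟩)
  obtain ⟨O, hO, hOD⟩ := isOpen_induced_iff.mp (e.open_source.preimage hβ.continuous)
  have heβ : ∀ z : D, e (β z) = z := fun z => by rw [← he]; exact hβ.proj_apply z
  refine ⟨β ⟨z₀, hz₀⟩, mem_interior.mpr ⟨e.source ∩ e ⁻¹' (O ∩ D), ?_,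
    e.isOpen_inter_preimage (hO.inter hD), hxe, ?_⟩⟩
  · rintro x ⟨hx, hxO, hxD⟩
    have h1 : (⟨e x, hxD⟩ : D) ∈ β ⁻¹' e.source := by rw [← hOD]; exact hxO
    exact ⟨⟨e x, hxD⟩, e.injOn h1 hx (heβ _)⟩
  · change e _ ∈ O ∩ D
    rw [heβ]
    have h2 : (⟨z₀, hz₀⟩ : D) ∈ Subtype.val ⁻¹' O := by rw [hOD]; exact hxe
    exact ⟨h2, hz₀⟩

variable {D : Set (Fin n → ℂ)} {N : ℕ → ℕ} {P : ∀ d, Fin (N d) → MvPolynomial (Fin n) ℂ}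
  {b : HilbertBasis (Σ d, Fin (N d)) ℂ (bergmanSpace D)}

/-- Every `L²_h`-extension of `D` projects into the set where `h_BK^* < 1`. -/
lemma IsL2hExtension.uscRegularization_hBK_lt_one (hD : IsOpen D) (hne : D.Nonempty)
    (hP : ∀ d j, (P d j).IsHomogeneous d)
    (hb : ∀ d j, (b ⟨d, j⟩ : Lp ℂ 2 (volume.restrict D))
      =ᵐ[volume.restrict D] fun z => MvPolynomial.eval z (P d j))
    {Z : RiemannDomain.{v} n} {β : D → Z.carrier} (hβ : IsL2hExtension D Z β) (x : Z.carrier) :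
    uscRegularization (hBK P) (Z.proj x) < 1 := by
  have : CompleteSpace (bergmanSpace D) := completeSpace_bergmanSpace hD
  have hext : ∀ g : bergmanSpace D, ∃ F : Z.carrier → ℂ, Z.IsHolomorphic F ∧
      (∃ f, IsL2h D f ∧ g =ᵐ[volume.restrict D] f ∧ ∀ z : D, F (β z) = f z) ∧
      ∀ d j, g = b ⟨d, j⟩ → ∀ y, F y = MvPolynomial.eval (Z.proj y) (P d j) := by
    intro g
    -- Each basis element is given the explicit extension P_{d,j} ∘ proj, so its values on Z are
    -- known without an identity theorem; any other g gets an arbitrary extension. Injectivity of b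
    -- makes the choice unambiguous.
    by_cases hg : ∃ s, g = b s
    · obtain ⟨⟨d, j⟩, rfl⟩ := hg
      refine ⟨_, Z.isHolomorphic_comp_proj (differentiable_eval (P d j)),
        ⟨_, isL2h_of_basis_eq hb d j, hb d j, fun z => ?_⟩, fun d' j' h y => ?_⟩
      · rw [Function.comp_apply, hβ.proj_apply]
      · have := b.orthonormal.linearIndependent.injective h
        obtain ⟨rfl, h⟩ := Sigma.mk.inj_iff.mp this
        obtain rfl := eq_of_heq h
        rfl
    · obtain ⟨f, hf, hgf⟩ := g.2
      obtain ⟨F, hF, hFβ⟩ := hβ.extends_l2h f hf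
      exact ⟨F, hF, ⟨f, hf, hgf, hFβ⟩, fun d j h => absurd ⟨_, h⟩ hg⟩
  choose F hF hFβ hFb using hext
  obtain ⟨r, hr, C, hC⟩ := Z.exists_clm_norm_le hF (hβ.nonempty_interior_range hD hne)
    (by
      rintro _ ⟨z, rfl⟩
      obtain ⟨r, hr, hrD⟩ := Metric.isOpen_iff.mp hD z z.2
      obtain ⟨C, -, hC⟩ := exists_clm_eq_apply (n := n) hr
      obtain ⟨L, -, hL⟩ := hC D z hrD
      refine ⟨L, fun g => ?_⟩
      obtain ⟨f, hf, hgf, hfβ⟩ := hFβ g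
      rw [hfβ, hL g f hf hgf]) x
  refine _root_.uscRegularization_hBK_lt_one hP Metric.isOpen_ball (fun w hw => ?_)
    (Metric.mem_ball_self hr)
  obtain ⟨y, rfl, L, hL, hLF⟩ := hC w hw
  refine hBK_le_one (C := C ^ 2) fun d => ?_
  simp_rw [← fun j => hFb _ d j rfl y, ← hLF]
  exact (b.sum_norm_apply_sq_le L d).trans (pow_le_pow_left₀ (norm_nonneg L) hL 2)

lemma isL2hExtension_inclusion {G : Set (Fin n → ℂ)} (hG : IsOpen G) (hc : IsConnected G)
    (hDG : D ⊆ G)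
    (hext : ∀ f, IsL2h D f →
      ∃ F : (Fin n → ℂ) → ℂ, DifferentiableOn ℂ F G ∧ ∀ z ∈ D, F z = f z) :
    IsL2hExtension D (RiemannDomain.ofDomain G hG hc) (Set.inclusion hDG) := by
  refine ⟨continuous_inclusion hDG, fun z => rfl, fun f hf => ?_⟩
  obtain ⟨F, hF, hFD⟩ := hext f hf
  refine ⟨fun x : G => F x, fun x => ?_, fun z => hFD z z.2⟩
  obtain ⟨e, hx, he⟩ := (RiemannDomain.ofDomain G hG hc).isLocalHomeomorph_proj x
  have hr : ∀ w ∈ e.target, (Subtype.val : G → Fin n → ℂ) (e.symm w) = w := fun w hw =>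
    (congrFun he (e.symm w)).trans (e.right_inv hw)
  refine ⟨e, hx, fun y _ => by rw [he], (hF.mono fun w hw => ?_).congr fun w hw => ?_⟩
  · rw [← hr w hw]
    exact Subtype.prop (p := (· ∈ G)) (e.symm w)
  · exact congrArg F (hr w hw)

end Envelope

end

theorem mainTheorem3 {n : ℕ} (h : (Fin n → ℂ) → ℝ) (hh : IsBalancedFunction h) :
    (∃ (N : ℕ → ℕ) (P : ∀ d, Fin (N d) → MvPolynomial (Fin n) ℂ),
      IsHomogeneousOrthonormalBasis (balancedDomain h) N P) ∧
    ∀ (N : ℕ → ℕ) (P : ∀ d, Fin (N d) → MvPolynomial (Fin n) ℂ),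
      IsHomogeneousOrthonormalBasis (balancedDomain h) N P →
        (∀ z, uscRegularization (hBK P) z ≠ ∞) ∧
        IsBalancedFunction (hBKStar P) ∧
        IsL2hEnvelopeDomain.{w} (balancedDomain h) (balancedDomain (hBKStar P)) := by
  refine ⟨hh.exists_isHomogeneousOrthonormalBasis, fun N P ⟨hP, b, hb⟩ => ?_⟩
  have hD := hh.isOpen
  have hball : ∀ z₀ ∈ balancedDomain h, ∃ r > 0, ∀ w ∈ Metric.ball z₀ r, hBK P w ≤ 1 := by
    intro z₀ hz₀
    obtain ⟨r, hr, C, -, hC⟩ := exists_sum_sq_eval_le hD hb hz₀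
    exact ⟨r, hr, fun w hw => hBK_le_one (hC w hw)⟩
  have hfin : ∀ z, uscRegularization (hBK P) z ≠ ∞ := by
    obtain ⟨r, hr, hle⟩ := hball 0 hh.zero_mem
    exact uscRegularization_hBK_ne_top hP Metric.isOpen_ball (Metric.mem_ball_self hr) hle
  have hbal := isBalancedFunction_hBKStar hP hfin
  have hDG : balancedDomain h ⊆ balancedDomain (hBKStar P) := by
    intro z hz
    obtain ⟨r, hr, hle⟩ := hball z hz
    exact (mem_balancedDomain_hBKStar hfin).mpr
      (uscRegularization_hBK_lt_one hP Metric.isOpen_ball hle (Metric.mem_ball_self hr))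
  have hG : {z | uscRegularization (hBK P) z < 1} = balancedDomain (hBKStar P) :=
    Set.ext fun z => (mem_balancedDomain_hBKStar hfin).symm
  refine ⟨hfin, hbal, hbal.isOpen, hbal.isConnected, hDG, ?_, fun Z β hβ => ?_⟩
  · refine isL2hExtension_inclusion _ _ _ fun f hf => ?_
    rw [← hG]
    exact exists_differentiableOn_extension hD hh.zero_mem hP hb hf
  -- The target is a subset of ℂⁿ, so a morphism into it can only be the projection of Z; what needs
  -- proof is that its values lie in the target.
  · have hmem : ∀ y, Z.proj y ∈ balancedDomain (hBKStar P) := fun y =>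
      (mem_balancedDomain_hBKStar hfin).mpr
        (hβ.uscRegularization_hBK_lt_one hD ⟨0, hh.zero_mem⟩ hP hb y)
    exact ⟨fun y => (⟨Z.proj y, hmem y⟩ : balancedDomain (hBKStar P)),
      Z.isLocalHomeomorph_proj.continuous.subtype_mk hmem, fun y => rfl,
      fun z => Subtype.ext (hβ.proj_apply z)⟩
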